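/- **Lemma (generalized Roth lemma).** Let $m,n\ge 1$ be integers and let $d=(d_1,\dots,d_m)$ be a tuple of positive integers. For a number field $K$ let $h$ denote the absolute logarithmic Weil height: $h(x)=\sum_{v}\log\max_i|x_i|_v$ for a nonzero vector $x$ over $K$, where $v$ runs over the places of $K$ and the absolute values are normalized by $|\alpha|_{\mathfrak p}=N(\mathfrak p)^{-\operatorname{ord}_{\mathfrak p}(\alpha)/[K:\mathbb Q]}$ at primes $\mathfrak p$ and by $|\alpha|_v=|\tau(\alpha)|^{d_v/[K:\mathbb Q]}$ at the archimedean place of an embedding $\tau$ ($d_v=1$ if $\tau$ is real, $d_v=2$ if $\tau$ is complex). The height of a nonzero polynomial or linear form is the height of its vector of coefficients. Let $\mathbf X_h=(X_{h,0},\dots,X_{h,n})$ for $h=1,\dots,m$ be blocks of variables. Let $P\neq 0$ be a polynomial in $\mathbf X_1,\dots,\mathbf X_m$ that is multihomogeneous of multidegree $d$, i.e. homogeneous of degree $d_h$ in $\mathbf X_h$ for each $h$, and let $M_1,\dots,M_m$ be nonzero linear forms in $n+1$ variables, where the coefficients of $P$ and of the $M_j$ lie in a number field $K\subset\overline{\mathbb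 Q}$. For real $t\ge 0$ let $\mathcal I(t;d;M)$ be the ideal of $\overline{\mathbb Q}[\mathbf X_1,\dots,\mathbf X_m]$ generated by all products $M_1(\mathbf X_1)^{j_1}\cdots M_m(\mathbf X_m)^{j_m}$ with integers $j_h\ge 0$ and $\frac{j_1}{d_1}+\dots+\frac{j_m}{d_m}\ge t$, and put $$\operatorname{Ind}(P;d;M):=\sup\{t\ge 0 \mid P\in\mathcal I(t;d;M)\}.$$ Let $\sigma\in(0,1/2]$ and suppose that 1. $d_{j+1}/d_j\le\sigma$ for $j=1,\dots,m-1$; 2. $\min_{1\le j\le m} d_j\,h(M_j)\ \ge\ n\,\sigma^{-1}\bigl(h(P)+4m\,d_1\bigr)$. Then $$\operatorname{Ind}(P;d;M)\le 2m\,\sigma^{1/2^{m-1}}.$$ -/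

import Mathlib

namespace GenRoth

open MvPolynomial

/-- The absolute logarithmic Weil height of the projective point with homogeneous coordinates
`x`, i.e. `∑_v log max_i |x_i|_v` over the places `v` of the number field `K`, with
`|x|_v = ‖x‖_v ^ (1 / [K : ℚ])`. Mathlib's `Height.logHeight` is the height relative to `K`
(finite places normalized by the ideal norm, complex places counted twice), so it is divided
by `[K : ℚ]`. -/
noncomputable def absHeight {K : Type*} [Field K] [NumberField K] {ι : Type*} (x : ι → K) : ℝ :=
  Height.logHeight x / (Module.finrank ℚ K : ℝ)

/-- The absolute logarithmic height of a polynomial: the height of its vector of coefficients. -/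
noncomputable def polyHeight {K : Type*} [Field K] [NumberField K] {τ : Type*}
    (P : MvPolynomial τ K) : ℝ :=
  absHeight (fun s : P.support => P.coeff s.1)

/-- `P` is multihomogeneous of multidegree `d` in the `m` blocks
`X_h = (X_{h,0}, …, X_{h,n})` of variables. -/
def IsMultihomogeneous {F : Type*} [CommSemiring F] {m n : ℕ} (d : Fin m → ℕ)
    (P : MvPolynomial (Fin m × Fin (n + 1)) F) : Prop :=
  ∀ s ∈ P.support, ∀ h : Fin m, ∑ i : Fin (n + 1), s (h, i) = d h

/-- The linear form `b_0 X_{h,0} + ⋯ + b_n X_{h,n}` in the `h`-th block of variables. -/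
noncomputable def linForm {F : Type*} [CommSemiring F] {m n : ℕ} (b : Fin (n + 1) → F)
    (h : Fin m) : MvPolynomial (Fin m × Fin (n + 1)) F :=
  ∑ i : Fin (n + 1), C (b i) * X (h, i)

/-- The ideal generated by the products `M_1(X_1)^{j_1} ⋯ M_m(X_m)^{j_m}` with
`j_1 / d_1 + ⋯ + j_m / d_m ≥ t`, where `M h` is the coefficient vector of the `h`-th form. -/
noncomputable def indexIdeal {F : Type*} [CommSemiring F] {m n : ℕ} (t : ℝ) (d : Fin m → ℕ)
    (M : Fin m → Fin (n + 1) → F) : Ideal (MvPolynomial (Fin m × Fin (n + 1)) F) :=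
  Ideal.span {f | ∃ J : Fin m → ℕ, t ≤ ∑ h : Fin m, (J h : ℝ) / (d h : ℝ) ∧
    f = ∏ h : Fin m, linForm (M h) h ^ J h}

/-- The index `sup {t ≥ 0 | P ∈ indexIdeal t d M}`, as an extended real number. -/
noncomputable def index {F : Type*} [CommSemiring F] {m n : ℕ} (d : Fin m → ℕ)
    (M : Fin m → Fin (n + 1) → F) (P : MvPolynomial (Fin m × Fin (n + 1)) F) : EReal :=
  sSup {y : EReal | ∃ t : ℝ, 0 ≤ t ∧ P ∈ indexIdeal t d M ∧ y = (t : EReal)}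

end GenRoth

/-!
For each form `M_h` pick an index `i₀` with `M_{h,i₀} ≠ 0` and an index `i₁ ≠ i₀` for which
`ξ_h = -M_{h,i₁} / M_{h,i₀}` has height at least `h(M_h) / n`. Expand `P` in the variables other
than `X_{h,i₀}` and `X_{h,i₁}`, put `X_{h,i₁} = 1`, and keep a nonzero coefficient `f` that is
minimal in this expansion: the coefficients of `f` are among those of `P`, and `f` vanishes at `ξ`
to weighted order at least the index of `P`. This reduces the statement to Roth's lemma for `f`.

Roth's lemma is proved by induction on the number of variables. Write `f = ∑ gⱼ hⱼ` with as few
terms as possible, where the `hⱼ` involve only the last variable and the `gⱼ` only the others. By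
minimality both families are linearly independent, so some generalized Wronskian of `f`, a
determinant of divided derivatives of `f`, is a nonzero product of a polynomial in the first
variables and one in the last. Their weighted orders are bounded by the induction hypothesis and by
Liouville's inequality, while the order of the determinant is large as soon as that of `f` is.
-/

namespace GenRoth

open MvPolynomial

section Degree

variable {ι R : Type*} [CommSemiring R]

theorem vars_subset_iff_degreeOf {f : MvPolynomial ι R} {S : Finset ι} :
    f.vars ⊆ S ↔ ∀ i ∉ S, degreeOf i f = 0 := by
  simp only [Finset.subset_iff, mem_vars_iff_degreeOf_ne_zero]
  exact forall_congr' fun i => not_imp_comm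

theorem apply_eq_zero_of_notMem_vars {f : MvPolynomial ι R} {s : ι →₀ ℕ} (hs : s ∈ f.support)
    {i : ι} (hi : i ∉ f.vars) : s i = 0 :=
  Finsupp.notMem_support_iff.1 fun h => hi ((mem_vars_iff_mem_support i).2 ⟨s, hs, h⟩)

theorem coeff_add_mul_of_disjoint_vars {f g : MvPolynomial ι R} (hfg : Disjoint f.vars g.vars)
    {s r : ι →₀ ℕ} (hs : s ∈ f.support) (hr : r ∈ g.support) :
    coeff (s + r) (f * g) = coeff s f * coeff r g := by
  classical
  rw [coeff_mul, Finset.sum_eq_single (s, r) _ fun h => absurd (by simp) h]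
  rintro ⟨a, b⟩ hab hne
  rw [Finset.HasAntidiagonal.mem_antidiagonal] at hab
  by_contra hcon
  have ha : a ∈ f.support := mem_support_iff.2 (left_ne_zero_of_mul hcon)
  have hb : b ∈ g.support := mem_support_iff.2 (right_ne_zero_of_mul hcon)
  have hagree (i : ι) : a i = s i ∧ b i = r i := by
    have hi : a i + b i = s i + r i := DFunLike.congr_fun hab i
    by_cases hif : i ∈ f.vars
    · have hig := Finset.disjoint_left.1 hfg hif
      rw [apply_eq_zero_of_notMem_vars hb hig, apply_eq_zero_of_notMem_vars hr hig] at hi ⊢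
      exact ⟨hi, rfl⟩
    · rw [apply_eq_zero_of_notMem_vars ha hif, apply_eq_zero_of_notMem_vars hs hif] at hi ⊢
      exact ⟨rfl, by simpa using hi⟩
  exact hne (Prod.ext (Finsupp.ext fun i => (hagree i).1) (Finsupp.ext fun i => (hagree i).2))

theorem card_support_le [Fintype ι] {D : ι → ℕ} {f : MvPolynomial ι R}
    (hf : ∀ i, degreeOf i f ≤ D i) : f.support.card ≤ 2 ^ ∑ i, D i := by
  classical
  calc f.support.card ≤ (Fintype.piFinset fun i => Finset.range (D i + 1)).card := by
        refine Finset.card_le_card_of_injOn (fun s => ⇑s) (fun s hs => ?_)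
          fun s _ r _ h => DFunLike.coe_injective h
        exact Fintype.mem_piFinset.2 fun i => Finset.mem_range.2
          (Nat.lt_succ_of_le (degreeOf_le_iff.1 (hf i) s hs))
    _ = ∏ i, (D i + 1) := by simp [Fintype.card_piFinset]
    _ ≤ ∏ i, 2 ^ D i := Finset.prod_le_prod' fun i _ => Nat.lt_two_pow_self
    _ = 2 ^ ∑ i, D i := Finset.prod_pow_eq_pow_sum _ _ _

theorem degreeOf_det_le {S : Type*} [CommRing S] {n : ℕ}
    {A : Matrix (Fin n) (Fin n) (MvPolynomial ι S)} {j : ι} {D : ℕ}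
    (hA : ∀ i c, degreeOf j (A i c) ≤ D) : degreeOf j A.det ≤ n * D := by
  rw [Matrix.det_apply]
  refine (degreeOf_sum_le j _ _).trans (Finset.sup_le fun τ _ => ?_)
  have hprod : degreeOf j (∏ i, A (τ i) i) ≤ n * D :=
    (degreeOf_prod_le j _ _).trans
      ((Finset.sum_le_card_nsmul _ _ D fun i _ => hA (τ i) i).trans_eq (by simp))
  rcases Int.units_eq_one_or (Equiv.Perm.sign τ) with h | h
  · simpa [h] using hprod
  · simpa [h] using hprod

end Degree

section Translate

variable {ι R : Type*} [CommSemiring R]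

/-- The substitution `X_i ↦ X_i + ξ_i`, which moves the point `ξ` to the origin. -/
noncomputable def translate (ξ : ι → R) : MvPolynomial ι R →ₐ[R] MvPolynomial ι R :=
  aeval fun i => X i + C (ξ i)

@[simp]
theorem translate_X (ξ : ι → R) (i : ι) : translate ξ (X i) = X i + C (ξ i) := by
  simp [translate]

theorem pderiv_translate (ξ : ι → R) (i : ι) (f : MvPolynomial ι R) :
    pderiv i (translate ξ f) = translate ξ (pderiv i f) := by
  classical
  induction f using MvPolynomial.induction_on with
  | C a => simp [translate]
  | add p q hp hq => simp [hp, hq]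
  | mul_X p j hp =>
    rw [map_mul, pderiv_mul, hp, pderiv_mul, map_add, map_mul, map_mul]
    congr 2
    by_cases h : j = i
    · subst h; simp
    · simp [pderiv_X_of_ne h]

theorem degreeOf_translate_le (ξ : ι → R) (i : ι) (f : MvPolynomial ι R) :
    degreeOf i (translate ξ f) ≤ degreeOf i f := by
  classical
  cases subsingleton_or_nontrivial R with
  | inl h => rw [Subsingleton.elim (translate ξ f) f]
  | inr h =>
  have hfactor (k : ι) : degreeOf i (X k + C (ξ k)) ≤ if k = i then 1 else 0 := by
    refine (degreeOf_add_le _ _ _).trans (max_le ?_ (by simp))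
    simp [degreeOf_X, eq_comm]
  conv_lhs => rw [f.as_sum, map_sum]
  refine (degreeOf_sum_le i _ _).trans (Finset.sup_le fun s hs => ?_)
  calc degreeOf i (translate ξ (monomial s (coeff s f)))
      = degreeOf i (C (coeff s f) * ∏ k ∈ s.support, (X k + C (ξ k)) ^ s k) := by
        rw [translate, aeval_monomial, algebraMap_eq, Finsupp.prod]
    _ ≤ ∑ k ∈ s.support, degreeOf i ((X k + C (ξ k)) ^ s k) :=
        (degreeOf_C_mul_le _ _ _).trans (degreeOf_prod_le _ _ _)
    _ ≤ ∑ k ∈ s.support, s k * if k = i then 1 else 0 :=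
        Finset.sum_le_sum fun k _ =>
          (degreeOf_pow_le _ _ _).trans (Nat.mul_le_mul_left _ (hfactor k))
    _ ≤ s i := by
        simp only [mul_ite, mul_one, mul_zero, Finset.sum_ite_eq']
        split_ifs <;> simp
    _ ≤ degreeOf i f := le_degreeOf_of_mem_support i hs

theorem vars_translate_subset (ξ : ι → R) (f : MvPolynomial ι R) :
    (translate ξ f).vars ⊆ f.vars :=
  vars_subset_iff_degreeOf.2 fun i hi => Nat.le_zero.1 <|
    (degreeOf_translate_le ξ i f).trans_eq <|
      not_not.1 fun h => hi (mem_vars_iff_degreeOf_ne_zero.2 h)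

theorem map_translate {S : Type*} [CommSemiring S] (φ : R →+* S) (ξ : ι → R)
    (f : MvPolynomial ι R) :
    map φ (translate ξ f) = translate (fun i => φ (ξ i)) (map φ f) := by
  induction f using MvPolynomial.induction_on with
  | C a => simp [translate]
  | add p q hp hq => simp [hp, hq]
  | mul_X p j hp => simp [hp]

theorem translate_neg_translate {S : Type*} [CommRing S] (ξ : ι → S) (f : MvPolynomial ι S) :
    translate (-ξ) (translate ξ f) = f := by
  have h : (translate (-ξ)).comp (translate ξ) = AlgHom.id S _ := by
    ext i : 1
    simp [translate]
  exact DFunLike.congr_fun h f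

theorem translate_injective {S : Type*} [CommRing S] (ξ : ι → S) :
    Function.Injective (translate ξ) :=
  Function.LeftInverse.injective (translate_neg_translate ξ)

theorem translate_ne_zero {S : Type*} [CommRing S] (ξ : ι → S) {f : MvPolynomial ι S}
    (hf : f ≠ 0) : translate ξ f ≠ 0 :=
  (map_ne_zero_iff _ (translate_injective ξ)).2 hf

end Translate

section OrderIdeal

variable {ι R : Type*}

/-- The weighted degree `∑ i, s i / d i` of an exponent vector `s`. -/
noncomputable def weight (d : ι → ℕ) : (ι →₀ ℕ) →+ ℝ :=
  Finsupp.weight fun i => (d i : ℝ)⁻¹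

theorem weight_apply (d : ι → ℕ) (s : ι →₀ ℕ) :
    weight d s = s.sum fun i k => (k : ℝ) * (d i : ℝ)⁻¹ := by
  simp [weight, Finsupp.weight_apply]

theorem weight_nonneg (d : ι → ℕ) (s : ι →₀ ℕ) : 0 ≤ weight d s := by
  rw [weight_apply]
  exact Finset.sum_nonneg fun i _ => by positivity

variable [CommSemiring R]

/-- The ideal of polynomials whose order of vanishing at the origin, with the variable `X_i`
counted with weight `1 / d i`, is at least `t`. -/
noncomputable def orderIdeal (d : ι → ℕ) (t : ℝ) : Ideal (MvPolynomial ι R) where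
  carrier := {f | ∀ s, coeff s f ≠ 0 → t ≤ weight d s}
  zero_mem' := fun s hs => absurd (coeff_zero s) hs
  add_mem' := by
    intro f g hf hg s hs
    by_cases h : coeff s f = 0
    · exact hg s fun h' => hs (by rw [coeff_add, h, h', add_zero])
    · exact hf s h
  smul_mem' := by
    classical
    intro f g hg s hs
    rw [smul_eq_mul, coeff_mul] at hs
    obtain ⟨⟨a, b⟩, hab, hne⟩ := Finset.exists_ne_zero_of_sum_ne_zero hs
    rw [← Finset.HasAntidiagonal.mem_antidiagonal.1 hab, map_add]
    exact le_add_of_nonneg_of_le (weight_nonneg d a) (hg b (right_ne_zero_of_mul hne))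

variable {d : ι → ℕ} {t u : ℝ} {f g : MvPolynomial ι R}

theorem mem_orderIdeal_iff : f ∈ orderIdeal d t ↔ ∀ s, coeff s f ≠ 0 → t ≤ weight d s :=
  Iff.rfl

theorem mem_orderIdeal_of_nonpos (d : ι → ℕ) (ht : t ≤ 0) (f : MvPolynomial ι R) :
    f ∈ orderIdeal d t :=
  fun s _ => ht.trans (weight_nonneg d s)

theorem mul_mem_orderIdeal (hf : f ∈ orderIdeal d t) (hg : g ∈ orderIdeal d u) :
    f * g ∈ orderIdeal d (t + u) := by
  classical
  intro s hs
  rw [coeff_mul] at hs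
  obtain ⟨⟨a, b⟩, hab, hne⟩ := Finset.exists_ne_zero_of_sum_ne_zero hs
  rw [← Finset.HasAntidiagonal.mem_antidiagonal.1 hab, map_add]
  exact add_le_add (hf a (left_ne_zero_of_mul hne)) (hg b (right_ne_zero_of_mul hne))

theorem prod_mem_orderIdeal {κ : Type*} {t : κ → ℝ} {f : κ → MvPolynomial ι R} (S : Finset κ)
    (hf : ∀ k ∈ S, f k ∈ orderIdeal d (t k)) :
    ∏ k ∈ S, f k ∈ orderIdeal d (∑ k ∈ S, t k) := by
  classical
  induction S using Finset.induction_on with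
  | empty => exact mem_orderIdeal_of_nonpos d (by simp) _
  | insert a S ha ih =>
    rw [Finset.sum_insert ha, Finset.prod_insert ha]
    exact mul_mem_orderIdeal (hf a (by simp)) (ih fun k hk => hf k (by simp [hk]))

theorem det_mem_orderIdeal {S : Type*} [CommRing S] {n : ℕ} {t : Fin n → ℝ}
    {A : Matrix (Fin n) (Fin n) (MvPolynomial ι S)} (hA : ∀ i j, A i j ∈ orderIdeal d (t j)) :
    A.det ∈ orderIdeal d (∑ j, t j) := by
  rw [Matrix.det_apply]
  refine Ideal.sum_mem _ fun τ _ => ?_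
  have hprod := prod_mem_orderIdeal Finset.univ fun i _ => hA (τ i) i
  rcases Int.units_eq_one_or (Equiv.Perm.sign τ) with h | h
  · simpa [h] using hprod
  · simpa [h] using hprod

theorem mem_orderIdeal_const_mul {n : ℕ} (hf : f ∈ orderIdeal d t) :
    f ∈ orderIdeal (fun i => n * d i) (t / n) := by
  intro s hs
  have hw : weight (fun i => n * d i) s = weight d s / n := by
    simp only [weight_apply, Finsupp.sum, Finset.sum_div]
    exact Finset.sum_congr rfl fun i _ => by push_cast; ring
  rw [hw]
  exact div_le_div_of_nonneg_right (hf s hs) n.cast_nonneg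

theorem exists_mem_orderIdeal_of_mul_mem [NoZeroDivisors R] (hfg : Disjoint f.vars g.vars)
    (hf : f ≠ 0) (hg : g ≠ 0) (h : f * g ∈ orderIdeal d t) :
    ∃ a b : ℝ, t ≤ a + b ∧ f ∈ orderIdeal d a ∧ g ∈ orderIdeal d b := by
  obtain ⟨s, hs, hsmin⟩ := f.support.exists_min_image (weight d) (support_nonempty.2 hf)
  obtain ⟨r, hr, hrmin⟩ := g.support.exists_min_image (weight d) (support_nonempty.2 hg)
  refine ⟨weight d s, weight d r, ?_, fun a ha => hsmin a (mem_support_iff.2 ha),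
    fun a ha => hrmin a (mem_support_iff.2 ha)⟩
  rw [← map_add]
  apply h
  rw [coeff_add_mul_of_disjoint_vars hfg hs hr]
  exact mul_ne_zero (mem_support_iff.1 hs) (mem_support_iff.1 hr)

theorem le_card_of_mem_orderIdeal {S : Finset ι} (hfS : f.vars ⊆ S)
    (hfd : ∀ i ∈ S, degreeOf i f ≤ d i) (hf : f ≠ 0) (h : f ∈ orderIdeal d t) : t ≤ S.card := by
  obtain ⟨s, hs⟩ := support_nonempty.2 hf
  have hsS : s.support ⊆ S := fun i hi => by
    by_contra hiS
    exact Finsupp.mem_support_iff.1 hi (apply_eq_zero_of_notMem_vars hs fun h => hiS (hfS h))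
  calc t ≤ weight d s := h s (mem_support_iff.1 hs)
    _ = ∑ i ∈ S, (s i : ℝ) / d i := by
        rw [weight_apply, Finsupp.sum_of_support_subset _ hsS _ (by simp)]
        rfl
    _ ≤ ∑ i ∈ S, 1 := Finset.sum_le_sum fun i hi => div_le_one_of_le₀
        (by exact_mod_cast (degreeOf_le_iff.1 (hfd i hi)) s hs) (Nat.cast_nonneg _)
    _ = S.card := by simp

end OrderIdeal

section HasseDeriv

variable {ι R : Type*} [Fintype ι] [CommSemiring R]

/-- The Hasse derivative `∂^e / e!`, which sends `X^s` to `∏ i, (s i).choose (e i) • X^(s - e)`.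
Its integral coefficients keep the heights of the derivatives of a polynomial small. -/
noncomputable def hasseDeriv (e : ι →₀ ℕ) : MvPolynomial ι R →ₗ[R] MvPolynomial ι R :=
  (basisMonomials ι R).constr R fun s =>
    monomial (s - e) ((∏ i, (s i).choose (e i) : ℕ) : R)

theorem hasseDeriv_monomial (e s : ι →₀ ℕ) (a : R) :
    hasseDeriv e (monomial s a) = monomial (s - e) (((∏ i, (s i).choose (e i) : ℕ) : R) * a) := by
  have h : monomial s a = a • basisMonomials ι R s := by
    simp [coe_basisMonomials, smul_monomial]
  rw [h, map_smul, hasseDeriv, Module.Basis.constr_basis, smul_monomial, smul_eq_mul, mul_comm]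

@[simp]
theorem hasseDeriv_zero (f : MvPolynomial ι R) : hasseDeriv 0 f = f := by
  induction f using MvPolynomial.induction_on' with
  | monomial s a => simp [hasseDeriv_monomial]
  | add p q hp hq => rw [map_add, hp, hq]

theorem coeff_hasseDeriv (e s : ι →₀ ℕ) (f : MvPolynomial ι R) :
    coeff s (hasseDeriv e f) =
      ((∏ i, (s i + e i).choose (e i) : ℕ) : R) * coeff (s + e) f := by
  classical
  induction f using MvPolynomial.induction_on' with
  | add p q hp hq => rw [map_add, coeff_add, hp, hq, coeff_add, mul_add]
  | monomial r a =>
    rw [hasseDeriv_monomial, coeff_monomial, coeff_monomial]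
    by_cases h : r = s + e
    · simp [h]
    rw [if_neg h, mul_zero]
    refine ite_eq_right_iff.2 fun hrs => ?_
    have hre : ¬ e ≤ r := fun hre => h (by rw [← hrs, tsub_add_cancel_of_le hre])
    obtain ⟨i, hi⟩ : ∃ i, r i < e i := by simpa [Finsupp.le_def] using hre
    rw [Finset.prod_eq_zero (Finset.mem_univ i) (Nat.choose_eq_zero_of_lt hi), Nat.cast_zero,
      zero_mul]

theorem add_mem_support_of_mem_support_hasseDeriv {e s : ι →₀ ℕ} {f : MvPolynomial ι R}
    (hs : s ∈ (hasseDeriv e f).support) : s + e ∈ f.support := by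
  rw [mem_support_iff, coeff_hasseDeriv] at hs
  exact mem_support_iff.2 (right_ne_zero_of_mul hs)

theorem degreeOf_hasseDeriv_le (e : ι →₀ ℕ) (i : ι) (f : MvPolynomial ι R) :
    degreeOf i (hasseDeriv e f) ≤ degreeOf i f :=
  degreeOf_le_iff.2 fun _ hs => (Nat.le_add_right _ _).trans
    (le_degreeOf_of_mem_support i (add_mem_support_of_mem_support_hasseDeriv hs))

theorem hasseDeriv_eq_zero_of_degreeOf_lt {e : ι →₀ ℕ} {i : ι} {f : MvPolynomial ι R}
    (h : degreeOf i f < e i) : hasseDeriv e f = 0 := by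
  refine support_eq_empty.1 (Finset.eq_empty_of_forall_notMem fun s hs => h.not_ge ?_)
  exact (Nat.le_add_left _ _).trans
    (le_degreeOf_of_mem_support i (add_mem_support_of_mem_support_hasseDeriv hs))

theorem hasseDeriv_mem_orderIdeal {d : ι → ℕ} {t : ℝ} {f : MvPolynomial ι R}
    (hf : f ∈ orderIdeal d t) (e : ι →₀ ℕ) :
    hasseDeriv e f ∈ orderIdeal d (t - weight d e) := by
  intro s hs
  rw [sub_le_iff_le_add, ← map_add]
  exact hf _ (mem_support_iff.1
    (add_mem_support_of_mem_support_hasseDeriv (mem_support_iff.2 hs)))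

theorem pderiv_hasseDeriv (e : ι →₀ ℕ) (i : ι) (f : MvPolynomial ι R) :
    pderiv i (hasseDeriv e f) = (e i + 1) • hasseDeriv (e + Finsupp.single i 1) f := by
  classical
  ext s
  set δ : ι →₀ ℕ := Finsupp.single i 1 with hδ
  have hchoose : (∏ k, ((s + δ) k + e k).choose (e k)) * (s i + 1) =
      (e i + 1) * ∏ k, (s k + (e + δ) k).choose ((e + δ) k) := by
    rw [← Finset.mul_prod_erase _ _ (Finset.mem_univ i),
      ← Finset.mul_prod_erase _ _ (Finset.mem_univ i), ← mul_assoc, mul_right_comm]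
    congr 1
    · have h := Nat.choose_succ_right_eq (s i + 1 + e i) (e i)
      rw [Nat.add_sub_cancel] at h
      simp only [Finsupp.add_apply, hδ, Finsupp.single_eq_same]
      rw [← h, mul_comm, add_right_comm, add_assoc]
    · exact Finset.prod_congr rfl fun k hk => by
        simp [hδ, Finsupp.single_eq_of_ne (Finset.ne_of_mem_erase hk)]
  rw [coeff_pderiv, coeff_smul, coeff_hasseDeriv, coeff_hasseDeriv, nsmul_eq_mul, ← hδ,
    add_right_comm, add_assoc s e, mul_right_comm, ← mul_assoc]
  congr 1
  exact_mod_cast congrArg (Nat.cast : ℕ → R) hchoose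

theorem hasseDeriv_mul_of_disjoint {S : Finset ι} {a b : ι →₀ ℕ} {f g : MvPolynomial ι R}
    (hf : Disjoint f.vars S) (ha : Disjoint a.support S) (hg : g.vars ⊆ S) (hb : b.support ⊆ S) :
    hasseDeriv (a + b) (f * g) = hasseDeriv a f * hasseDeriv b g := by
  have hcases (s : ι →₀ ℕ) (hs : s ∈ f.support) (r : ι →₀ ℕ) (hr : r ∈ g.support) (i : ι) :
      (s i = 0 ∧ a i = 0) ∨ (r i = 0 ∧ b i = 0) := by
    by_cases hi : i ∈ S
    · exact .inl ⟨apply_eq_zero_of_notMem_vars hs (Finset.disjoint_right.1 hf hi),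
        Finsupp.notMem_support_iff.1 (Finset.disjoint_right.1 ha hi)⟩
    · exact .inr ⟨apply_eq_zero_of_notMem_vars hr (fun h => hi (hg h)),
        Finsupp.notMem_support_iff.1 fun h => hi (hb h)⟩
  conv_lhs => rw [f.as_sum, g.as_sum]
  conv_rhs => rw [f.as_sum, g.as_sum]
  rw [Finset.sum_mul_sum]
  simp only [map_sum]
  rw [Finset.sum_mul_sum]
  refine Finset.sum_congr rfl fun s hs => Finset.sum_congr rfl fun r hr => ?_
  have hsub : s + r - (a + b) = s - a + (r - b) := by
    ext i
    rcases hcases s hs r hr i with h | h <;> simp [h]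
  have hchoose : ∏ i, ((s + r) i).choose ((a + b) i) =
      (∏ i, (s i).choose (a i)) * ∏ i, (r i).choose (b i) := by
    rw [← Finset.prod_mul_distrib]
    refine Finset.prod_congr rfl fun i _ => ?_
    rcases hcases s hs r hr i with h | h <;> simp [h]
  rw [monomial_mul, hasseDeriv_monomial, hasseDeriv_monomial, hasseDeriv_monomial, monomial_mul,
    hsub, hchoose]
  congr 1
  push_cast
  ring

theorem hasseDeriv_translate {S : Type*} [CommRing S] [IsDomain S] [CharZero S] (e : ι →₀ ℕ)
    (ξ : ι → S) (f : MvPolynomial ι S) :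
    hasseDeriv e (translate ξ f) = translate ξ (hasseDeriv e f) := by
  classical
  induction e using Finsupp.induction with
  | zero => simp
  | single_add i k e _ hk ih =>
    clear hk
    induction k with
    | zero => simpa using ih
    | succ k ihk =>
      have h := pderiv_hasseDeriv (Finsupp.single i k + e) i (translate ξ f)
      rw [ihk, pderiv_translate, pderiv_hasseDeriv, map_nsmul, add_right_comm,
        ← Finsupp.single_add] at h
      exact (smul_right_injective _ (Nat.succ_ne_zero _) h).symm

end HasseDeriv

section Wronskian

variable {ι K : Type*} [Field K]

theorem coeff_X_mul_pderiv {R : Type*} [CommSemiring R] (i : ι) (p : MvPolynomial ι R)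
    (s : ι →₀ ℕ) : coeff s (X i * pderiv i p) = (s i : R) * coeff s p := by
  classical
  induction p using MvPolynomial.induction_on' with
  | monomial r a =>
    rw [X_mul_pderiv_monomial, coeff_smul, coeff_monomial, nsmul_eq_mul]
    split_ifs with hrs
    · rw [hrs]
    · simp
  | add p q hp hq => rw [map_add, mul_add, coeff_add, hp, hq, coeff_add, mul_add]

theorem degree_X_mul_pderiv_le {R : Type*} [CommSemiring R] (o : MonomialOrder ι) (i : ι)
    (p : MvPolynomial ι R) : o.toSyn (o.degree (X i * pderiv i p)) ≤ o.toSyn (o.degree p) := by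
  refine o.degree_le_iff.2 fun s hs => ?_
  rw [mem_support_iff, coeff_X_mul_pderiv] at hs
  exact o.le_degree (mem_support_iff.2 (right_ne_zero_of_mul hs))

theorem degree_eq_of_mul_pderiv_eq {R : Type*} [CommRing R] [IsDomain R] [CharZero R]
    (o : MonomialOrder ι) {f g : MvPolynomial ι R} (hf : f ≠ 0) (hg : g ≠ 0)
    (h : ∀ i, f * pderiv i g = g * pderiv i f) : o.degree f = o.degree g := by
  ext i
  have hlf := o.leadingCoeff_ne_zero_iff.2 hf
  have hlg := o.leadingCoeff_ne_zero_iff.2 hg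
  have hfg := o.coeff_mul_of_add_of_degree_le le_rfl (degree_X_mul_pderiv_le o i g) (f := f)
  have hgf := o.coeff_mul_of_add_of_degree_le le_rfl (degree_X_mul_pderiv_le o i f) (f := g)
  have hEuler : f * (X i * pderiv i g) = g * (X i * pderiv i f) := by
    linear_combination X i * h i
  rw [hEuler, add_comm, hgf, coeff_X_mul_pderiv, coeff_X_mul_pderiv] at hfg
  have hzero : o.leadingCoeff f * o.leadingCoeff g *
      ((o.degree f i : R) - (o.degree g i : R)) = 0 := by
    simp only [MonomialOrder.leadingCoeff]
    linear_combination hfg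
  exact_mod_cast sub_eq_zero.1 ((mul_eq_zero.1 hzero).resolve_left (mul_ne_zero hlf hlg))

theorem exists_eq_C_mul_of_mul_pderiv_eq [Finite ι] [CharZero K] {f g : MvPolynomial ι K}
    (hg : g ≠ 0) (h : ∀ i, g * pderiv i f = f * pderiv i g) : ∃ c : K, f = C c * g := by
  classical
  have := linearOrderOfSTO (WellOrderingRel (α := ι))
  let o : MonomialOrder ι := MonomialOrder.lex
  have hlg : coeff (o.degree g) g ≠ 0 := o.leadingCoeff_ne_zero_iff.2 hg
  refine ⟨coeff (o.degree g) f / coeff (o.degree g) g, ?_⟩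
  by_contra hne
  set r := f - C (coeff (o.degree g) f / coeff (o.degree g) g) * g with hr
  have hr0 : r ≠ 0 := sub_ne_zero.2 hne
  have hdeg : o.degree r = o.degree g := by
    refine (degree_eq_of_mul_pderiv_eq o hg hr0 fun i => ?_).symm
    simp only [hr, map_sub, pderiv_C_mul]
    linear_combination h i
  refine o.leadingCoeff_ne_zero_iff.2 hr0 ?_
  rw [MonomialOrder.leadingCoeff, hdeg, hr, coeff_sub, coeff_C_mul, div_mul_cancel₀ _ hlg, sub_self]

/-- The signed maximal minors of an `n × (n + 1)` matrix, that is, the cofactors of a row appended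
below it. -/
noncomputable def signedMinor {R : Type*} [CommRing R] {n : ℕ} (A : Matrix (Fin n) (Fin (n + 1)) R)
    (j : Fin (n + 1)) : R :=
  (-1) ^ (n + (j : ℕ)) * (A.submatrix id j.succAbove).det

theorem signedMinor_last {R : Type*} [CommRing R] {n : ℕ} (A : Matrix (Fin n) (Fin (n + 1)) R) :
    signedMinor A (Fin.last n) = (A.submatrix id Fin.castSucc).det := by
  simp only [signedMinor, Fin.val_last, Fin.succAbove_last, (Even.add_self n).neg_one_pow, one_mul]

theorem det_eq_sum_mul_signedMinor {R : Type*} [CommRing R] {n : ℕ}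
    (B : Matrix (Fin (n + 1)) (Fin (n + 1)) R) :
    B.det = ∑ j, B (Fin.last n) j * signedMinor (B.submatrix Fin.castSucc id) j := by
  rw [Matrix.det_succ_row _ (Fin.last n)]
  refine Finset.sum_congr rfl fun j _ => ?_
  rw [signedMinor, Matrix.submatrix_submatrix, Fin.succAbove_last, Fin.val_last, Function.comp_id,
    Function.id_comp]
  ring

theorem mul_eq_mul_of_mulVec_eq_zero {R : Type*} [CommRing R] [IsDomain R] {n : ℕ}
    {A : Matrix (Fin n) (Fin (n + 1)) R} (hA : (A.submatrix id Fin.castSucc).det ≠ 0)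
    {a b : Fin (n + 1) → R} (ha : A.mulVec a = 0) (hb : A.mulVec b = 0) (j : Fin (n + 1)) :
    a (Fin.last n) * b j = a j * b (Fin.last n) := by
  have hker : (A.submatrix id Fin.castSucc).mulVec (fun j =>
      a (Fin.last n) * b j.castSucc - a j.castSucc * b (Fin.last n)) = 0 := by
    ext i
    have hai := congrFun ha i
    have hbi := congrFun hb i
    simp only [Matrix.mulVec, dotProduct, Fin.sum_univ_castSucc, Pi.zero_apply] at hai hbi
    simp only [Matrix.mulVec, dotProduct, Matrix.submatrix_apply, id_eq, Pi.zero_apply, mul_sub,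
      Finset.sum_sub_distrib, mul_left_comm _ (a (Fin.last n)), ← mul_assoc _ _ (b (Fin.last n)),
      ← Finset.mul_sum, ← Finset.sum_mul]
    linear_combination a (Fin.last n) * hbi - b (Fin.last n) * hai
  refine Fin.lastCases rfl (fun j => ?_) j
  exact sub_eq_zero.1 (congrFun (Matrix.eq_zero_of_mulVec_eq_zero hA hker) j)

theorem exists_signedMinor_eq_C_mul [Fintype ι] [CharZero K] {n : ℕ}
    {f : Fin (n + 1) → MvPolynomial ι K} {e : Fin n → ι →₀ ℕ} (he : ∀ i, (e i).degree < n)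
    (hdet : (Matrix.of fun i j => hasseDeriv (e i) (f (Fin.castSucc j))).det ≠ 0)
    (hrel : ∀ s : ι →₀ ℕ, s.degree ≤ n → ∑ j, hasseDeriv s (f j) *
      signedMinor (Matrix.of fun i j => hasseDeriv (e i) (f j)) j = 0) :
    ∃ c : Fin (n + 1) → K, ∀ j,
      signedMinor (Matrix.of fun i j => hasseDeriv (e i) (f j)) j =
        C (c j) * signedMinor (Matrix.of fun i j => hasseDeriv (e i) (f j)) (Fin.last n) := by
  set A : Matrix (Fin n) (Fin (n + 1)) (MvPolynomial ι K) :=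
    Matrix.of fun i j => hasseDeriv (e i) (f j)
  have hlast : signedMinor A (Fin.last n) ≠ 0 := by rwa [signedMinor_last]
  refine Classical.skolem.1 fun j => exists_eq_C_mul_of_mul_pderiv_eq hlast fun i =>
    mul_eq_mul_of_mulVec_eq_zero hdet (A := A) (b := fun j => pderiv i (signedMinor A j)) ?_ ?_ j
  · ext k : 1
    exact hrel (e k) (he k).le
  · ext k : 1
    have hder := congrArg (pderiv i) (hrel (e k) (he k).le)
    simp only [map_sum, pderiv_mul, Finset.sum_add_distrib, pderiv_hasseDeriv, smul_mul_assoc,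
      ← Finset.smul_sum, map_zero] at hder
    rwa [hrel _ (by simpa using he k), smul_zero, zero_add] at hder

theorem exists_det_hasseDeriv_ne_zero [Fintype ι] [CharZero K] (n : ℕ)
    (f : Fin n → MvPolynomial ι K) (hf : LinearIndependent K f) :
    ∃ e : Fin n → ι →₀ ℕ, (∀ i, (e i).degree ≤ i) ∧
      (Matrix.of fun i j => hasseDeriv (e i) (f j)).det ≠ 0 := by
  induction n with
  | zero => exact ⟨fun i => i.elim0, fun i => i.elim0, by simp⟩
  | succ n ih =>
    obtain ⟨e, he, hdet⟩ := ih (fun j => f j.castSucc) (hf.comp _ (Fin.castSucc_injective n))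
    let A : Matrix (Fin n) (Fin (n + 1)) (MvPolynomial ι K) :=
      Matrix.of fun i j => hasseDeriv (e i) (f j)
    have hlast : signedMinor A (Fin.last n) ≠ 0 := by rwa [signedMinor_last]
    by_contra! hcon
    have hrel (s : ι →₀ ℕ) (hs : s.degree ≤ n) :
        ∑ j, hasseDeriv s (f j) * signedMinor A j = 0 := by
      have hdet_snoc := hcon (Fin.snoc (α := fun _ => ι →₀ ℕ) e s) <|
        Fin.lastCases (by simpa using hs) fun i => by simpa using he i
      simp only [det_eq_sum_mul_signedMinor, Matrix.of_apply, Fin.snoc_last] at hdet_snoc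
      convert hdet_snoc using 4
      ext i j : 2
      simp [A]
    obtain ⟨c, hc⟩ := exists_signedMinor_eq_C_mul (fun i => (he i).trans_lt i.2) hdet hrel
    have hdep : ∑ j, c j • f j = 0 := by
      refine (mul_eq_zero.1 ?_).resolve_left hlast
      rw [← hrel 0 (by simp), Finset.mul_sum]
      refine Finset.sum_congr rfl fun j _ => ?_
      rw [hasseDeriv_zero, hc j, smul_eq_C_mul]
      ring
    exact hlast (by rw [hc, Fintype.linearIndependent_iff.1 hf c hdep, map_zero, zero_mul])

end Wronskian

section Height

open Height AdmissibleAbsValues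

theorem hasFiniteMulSupport_iSup {K ι : Type*} [Field K] [AdmissibleAbsValues K] [Finite ι]
    {x : ι → K} (hx : x ≠ 0) :
    (fun v : nonarchAbsVal (K := K) => ⨆ i, v.val (x i)).HasFiniteMulSupport := by
  obtain ⟨k, hk⟩ := Function.ne_iff.1 hx
  have : Nonempty ι := ⟨k⟩
  refine Set.Finite.subset (Set.finite_iUnion fun i : {i // x i ≠ 0} =>
    hasFiniteMulSupport i.2) fun v hv => ?_
  by_contra hout
  have hone (i : ι) (hi : x i ≠ 0) : v.val (x i) = 1 := by
    by_contra h
    exact hout (Set.mem_iUnion.2 ⟨⟨i, hi⟩, h⟩)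
  refine hv (le_antisymm (ciSup_le fun i => ?_) (Finite.le_ciSup_of_le k (hone k hk).ge))
  by_cases hi : x i = 0
  · simp [hi]
  · exact (hone i hi).le

theorem logHeight_le_of_local {K ι κ : Type*} [Field K] [AdmissibleAbsValues K] [Finite ι]
    [Finite κ] {x : ι → K} {y : κ → K} (hx : x ≠ 0) (hy : y ≠ 0) (N : ℕ) {A : ℝ} (hA : 0 < A)
    (harch : ∀ v ∈ archAbsVal (K := K), ∀ i, v (x i) ≤ A * (⨆ j, v (y j)) ^ N)
    (hnon : ∀ v ∈ nonarchAbsVal (K := K), ∀ i, v (x i) ≤ (⨆ j, v (y j)) ^ N) :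
    logHeight x ≤ totalWeight K * Real.log A + N * logHeight y := by
  have : Nonempty ι := ⟨(Function.ne_iff.1 hx).choose⟩
  have hsup_nonneg (v : AbsoluteValue K ℝ) : 0 ≤ ⨆ j, v (y j) :=
    Real.iSup_nonneg_of_nonnegHomClass v _
  have hmul : mulHeight x ≤ A ^ totalWeight K * mulHeight y ^ N := by
    have hfin_y := hasFiniteMulSupport_iSup hy
    rw [mulHeight_eq hx, mulHeight_eq hy, mul_pow, ← mul_assoc, ← Multiset.prod_map_pow,
      totalWeight, ← Multiset.prod_replicate, ← Multiset.map_const', ← Multiset.prod_map_mul,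
      finprod_pow hfin_y]
    gcongr
    · exact finprod_nonneg fun v => Real.iSup_nonneg_of_nonnegHomClass v.val _
    · exact Multiset.prod_map_nonneg fun v _ => mul_nonneg hA.le (pow_nonneg (hsup_nonneg v) _)
    · exact Multiset.prod_map_le_prod_map₀ _ _
        (fun v _ => Real.iSup_nonneg_of_nonnegHomClass v _) fun v hv => ciSup_le (harch v hv)
    · exact finprod_le_finprod (hasFiniteMulSupport_iSup hx)
        (fun v => Real.iSup_nonneg_of_nonnegHomClass v.val _) (hfin_y.pow N)
        fun v => ciSup_le (hnon v.1 v.2)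
  have hlog := Real.log_le_log (mulHeight_pos x) hmul
  rwa [Real.log_mul (pow_pos hA _).ne' (pow_pos (mulHeight_pos y) _).ne', Real.log_pow,
    Real.log_pow, ← logHeight_eq_log_mulHeight, ← logHeight_eq_log_mulHeight] at hlog

variable {ι κ K : Type*} [Field K] [NumberField K]

theorem absHeight_le_of_local [Finite ι] [Finite κ] {x : ι → K} {y : κ → K} (hx : x ≠ 0)
    (hy : y ≠ 0) (N : ℕ) {A : ℝ} (hA : 0 < A)
    (harch : ∀ v ∈ archAbsVal (K := K), ∀ i, v (x i) ≤ A * (⨆ j, v (y j)) ^ N)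
    (hnon : ∀ v ∈ nonarchAbsVal (K := K), ∀ i, v (x i) ≤ (⨆ j, v (y j)) ^ N) :
    absHeight x ≤ Real.log A + N * absHeight y := by
  have hrank : (0 : ℝ) < Module.finrank ℚ K := mod_cast Module.finrank_pos
  have h := logHeight_le_of_local hx hy N hA harch hnon
  rw [NumberField.totalWeight_eq_finrank] at h
  rw [absHeight, absHeight, div_le_iff₀ hrank]
  refine h.trans_eq ?_
  field_simp

theorem absHeight_nonneg [Finite ι] (x : ι → K) : 0 ≤ absHeight x :=
  div_nonneg (logHeight_nonneg x) (Nat.cast_nonneg _)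

theorem absHeight_comp_le [Finite ι] [Finite κ] (f : ι → κ) (x : κ → K) :
    absHeight (x ∘ f) ≤ absHeight x :=
  div_le_div_of_nonneg_right (logHeight_comp_le f x) (Nat.cast_nonneg _)

theorem absHeight_smul [Finite ι] (x : ι → K) {c : K} (hc : c ≠ 0) :
    absHeight (c • x) = absHeight x := by
  rw [absHeight, absHeight, logHeight_smul_eq_logHeight x hc]

theorem polyHeight_nonneg (P : MvPolynomial ι K) : 0 ≤ polyHeight P :=
  absHeight_nonneg _

theorem polyHeight_le_of_coeff_eq {P : MvPolynomial ι K} {Q : MvPolynomial κ K}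
    (e : (κ →₀ ℕ) → ι →₀ ℕ) (h : ∀ s ∈ Q.support, coeff s Q = coeff (e s) P) :
    polyHeight Q ≤ polyHeight P := by
  have hmem (s : Q.support) : e s.1 ∈ P.support := by
    rw [mem_support_iff, ← h s.1 s.2]
    exact mem_support_iff.1 s.2
  have hcoeff : (fun s : Q.support => Q.coeff s.1) =
      (fun r : P.support => P.coeff r.1) ∘ fun s => ⟨e s.1, hmem s⟩ :=
    funext fun s => h s.1 s.2
  rw [polyHeight, hcoeff]
  exact absHeight_comp_le _ _

theorem coeff_restrict_support_ne_zero {R : Type*} [CommSemiring R] {P : MvPolynomial ι R}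
    (hP : P ≠ 0) : (fun s : P.support => P.coeff s.1) ≠ 0 := by
  obtain ⟨s, hs⟩ := support_nonempty.2 hP
  exact Function.ne_iff.2 ⟨⟨s, hs⟩, mem_support_iff.1 hs⟩

theorem polyHeight_add_le_of_disjoint_vars {f g : MvPolynomial ι K}
    (hfg : Disjoint f.vars g.vars) (hf : f ≠ 0) (hg : g ≠ 0) :
    polyHeight f + polyHeight g ≤ polyHeight (f * g) := by
  have hcoeff (a : f.support × g.support) :
      coeff (a.1.1 + a.2.1) (f * g) = coeff a.1.1 f * coeff a.2.1 g :=
    coeff_add_mul_of_disjoint_vars hfg a.1.2 a.2.2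
  have hmem (a : f.support × g.support) : a.1.1 + a.2.1 ∈ (f * g).support := by
    rw [mem_support_iff, hcoeff]
    exact mul_ne_zero (mem_support_iff.1 a.1.2) (mem_support_iff.1 a.2.2)
  calc polyHeight f + polyHeight g
      = absHeight fun a : f.support × g.support => coeff a.1.1 f * coeff a.2.1 g := by
        rw [polyHeight, polyHeight, absHeight, absHeight, ← add_div,
          ← logHeight_fun_mul_eq (coeff_restrict_support_ne_zero hf)
            (coeff_restrict_support_ne_zero hg), absHeight]
    _ = absHeight ((fun s : (f * g).support => (f * g).coeff s.1) ∘
          fun a : f.support × g.support => ⟨a.1.1 + a.2.1, hmem a⟩) :=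
        congrArg absHeight (funext fun a => (hcoeff a).symm)
    _ ≤ polyHeight (f * g) := absHeight_comp_le _ _

end Height

section LocalBounds

variable {ι κ R : Type*} [CommRing R] (v : AbsoluteValue R ℝ)

/-- The largest absolute value of a coefficient, which is the local factor at `v` of the height of
a polynomial. It is `0` for the zero polynomial. -/
noncomputable def coeffSup (f : MvPolynomial ι R) : ℝ :=
  ⨆ s : f.support, v (coeff s.1 f)

/-- The sum of the absolute values of the coefficients. Unlike `coeffSup` it is submultiplicative
at the archimedean places. -/
noncomputable def length (f : MvPolynomial ι R) : ℝ :=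
  ∑ s ∈ f.support, v (coeff s f)

theorem coeffSup_nonneg (f : MvPolynomial ι R) : 0 ≤ coeffSup v f :=
  Real.iSup_nonneg_of_nonnegHomClass v _

theorem abv_coeff_le_coeffSup (f : MvPolynomial ι R) (s : ι →₀ ℕ) :
    v (coeff s f) ≤ coeffSup v f := by
  by_cases hs : s ∈ f.support
  · exact Finite.le_ciSup_of_le (⟨s, hs⟩ : f.support) le_rfl
  · rw [notMem_support_iff.1 hs, map_zero]
    exact coeffSup_nonneg v f

theorem coeffSup_le {f : MvPolynomial ι R} {B : ℝ} (hB : 0 ≤ B) (hf : ∀ s, v (coeff s f) ≤ B) :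
    coeffSup v f ≤ B :=
  Real.iSup_le (fun s => hf s) hB

theorem length_nonneg (f : MvPolynomial ι R) : 0 ≤ length v f :=
  Finset.sum_nonneg fun _ _ => v.nonneg _

theorem length_eq_sum_of_support_subset {f : MvPolynomial ι R} {T : Finset (ι →₀ ℕ)}
    (hT : f.support ⊆ T) : length v f = ∑ s ∈ T, v (coeff s f) :=
  Finset.sum_subset hT fun s _ hs => by rw [notMem_support_iff.1 hs, map_zero]

theorem coeffSup_le_length (f : MvPolynomial ι R) : coeffSup v f ≤ length v f :=
  Real.iSup_le (fun s => Finset.single_le_sum (f := fun s => v (coeff s f))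
    (fun _ _ => v.nonneg _) s.2) (length_nonneg v f)

theorem length_add_le (f g : MvPolynomial ι R) : length v (f + g) ≤ length v f + length v g := by
  classical
  rw [length_eq_sum_of_support_subset v (support_add (p := f) (q := g)),
    length_eq_sum_of_support_subset v Finset.subset_union_left,
    length_eq_sum_of_support_subset v Finset.subset_union_right, ← Finset.sum_add_distrib]
  exact Finset.sum_le_sum fun s _ => by rw [coeff_add]; exact v.add_le _ _

theorem length_sum_le (T : Finset κ) (f : κ → MvPolynomial ι R) :
    length v (∑ k ∈ T, f k) ≤ ∑ k ∈ T, length v (f k) :=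
  Finset.le_sum_of_subadditive _ (by simp [length]) (length_add_le v) _ _

theorem length_monomial_le (s : ι →₀ ℕ) (a : R) : length v (monomial s a) ≤ v a := by
  classical
  rw [length_eq_sum_of_support_subset v support_monomial_subset]
  simp

theorem length_mul_le (f g : MvPolynomial ι R) : length v (f * g) ≤ length v f * length v g := by
  have hrhs : length v f * length v g =
      ∑ s ∈ f.support, ∑ r ∈ g.support, v (coeff s f) * v (coeff r g) :=
    Finset.sum_mul_sum _ _ _ _
  conv_lhs => rw [f.as_sum, g.as_sum, Finset.sum_mul_sum]
  rw [hrhs]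
  refine (length_sum_le v _ _).trans (Finset.sum_le_sum fun s _ =>
    (length_sum_le v _ _).trans (Finset.sum_le_sum fun r _ => ?_))
  rw [monomial_mul, ← map_mul]
  exact length_monomial_le v _ _

theorem length_prod_le [Nontrivial R] (T : Finset κ) (f : κ → MvPolynomial ι R) :
    length v (∏ k ∈ T, f k) ≤ ∏ k ∈ T, length v (f k) := by
  classical
  induction T using Finset.induction_on with
  | empty => simpa using length_monomial_le v (0 : ι →₀ ℕ) 1
  | insert a T ha ih =>
    rw [Finset.prod_insert ha, Finset.prod_insert ha]
    exact (length_mul_le v _ _).trans (mul_le_mul_of_nonneg_left ih (length_nonneg v _))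

theorem length_det_le [Nontrivial R] {n : ℕ} {A : Matrix (Fin n) (Fin n) (MvPolynomial ι R)} {B : ℝ}
    (hA : ∀ i j, length v (A i j) ≤ B) : length v A.det ≤ n.factorial * B ^ n := by
  have hterm (τ : Equiv.Perm (Fin n)) :
      length v (Equiv.Perm.sign τ • ∏ i, A (τ i) i) ≤ B ^ n := by
    have hsign : length v (Equiv.Perm.sign τ • ∏ i, A (τ i) i) = length v (∏ i, A (τ i) i) := by
      rcases Int.units_eq_one_or (Equiv.Perm.sign τ) with h | h <;> simp [h, length]
    rw [hsign]
    refine (length_prod_le v _ _).trans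
      ((Finset.prod_le_prod (fun i _ => length_nonneg v _) fun i _ => hA (τ i) i).trans_eq ?_)
    simp
  rw [Matrix.det_apply]
  refine (length_sum_le v _ _).trans ((Finset.sum_le_sum fun τ _ => hterm τ).trans_eq ?_)
  simp [Fintype.card_perm]

variable {v}

theorem abv_sum_le_of_isNonarchimedean (hv : IsNonarchimedean v) {T : Finset κ} {f : κ → R}
    {B : ℝ} (hB : 0 ≤ B) (hf : ∀ k ∈ T, v (f k) ≤ B) : v (∑ k ∈ T, f k) ≤ B :=
  hv.apply_sum_le.trans (Real.iSup_le (fun k => hf k k.2) hB)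

theorem coeffSup_mul_le (hv : IsNonarchimedean v) (f g : MvPolynomial ι R) :
    coeffSup v (f * g) ≤ coeffSup v f * coeffSup v g := by
  classical
  have hB := mul_nonneg (coeffSup_nonneg v f) (coeffSup_nonneg v g)
  refine coeffSup_le v hB fun s => ?_
  rw [coeff_mul]
  refine abv_sum_le_of_isNonarchimedean hv hB fun p _ => ?_
  rw [map_mul]
  exact mul_le_mul (abv_coeff_le_coeffSup v f _) (abv_coeff_le_coeffSup v g _) (v.nonneg _)
    (coeffSup_nonneg v f)

theorem coeffSup_prod_le [Nontrivial R] (hv : IsNonarchimedean v) (T : Finset κ)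
    (f : κ → MvPolynomial ι R) :
    coeffSup v (∏ k ∈ T, f k) ≤ ∏ k ∈ T, coeffSup v (f k) := by
  classical
  induction T using Finset.induction_on with
  | empty => simpa using (coeffSup_le_length v _).trans (length_monomial_le v (0 : ι →₀ ℕ) 1)
  | insert a T ha ih =>
    rw [Finset.prod_insert ha, Finset.prod_insert ha]
    exact (coeffSup_mul_le hv _ _).trans (mul_le_mul_of_nonneg_left ih (coeffSup_nonneg v _))

theorem coeffSup_det_le [Nontrivial R] (hv : IsNonarchimedean v) {n : ℕ}
    {A : Matrix (Fin n) (Fin n) (MvPolynomial ι R)} {B : ℝ} (hB : 0 ≤ B)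
    (hA : ∀ i j, coeffSup v (A i j) ≤ B) : coeffSup v A.det ≤ B ^ n := by
  refine coeffSup_le v (pow_nonneg hB n) fun s => ?_
  rw [Matrix.det_apply, coeff_sum]
  refine abv_sum_le_of_isNonarchimedean hv (pow_nonneg hB n) fun τ _ => ?_
  have hprod : v (coeff s (∏ i, A (τ i) i)) ≤ B ^ n :=
    (abv_coeff_le_coeffSup v _ s).trans <| (coeffSup_prod_le hv _ _).trans <|
      (Finset.prod_le_prod (fun i _ => coeffSup_nonneg v _) fun i _ => hA (τ i) i).trans_eq
        (by simp)
  rcases Int.units_eq_one_or (Equiv.Perm.sign τ) with h | h <;> simpa [h] using hprod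

theorem coeffSup_hasseDeriv_le [Fintype ι] [Nontrivial R] (hv : IsNonarchimedean v) (e : ι →₀ ℕ)
    (P : MvPolynomial ι R) : coeffSup v (hasseDeriv e P) ≤ coeffSup v P := by
  refine coeffSup_le v (coeffSup_nonneg v P) fun s => ?_
  rw [coeff_hasseDeriv, map_mul]
  exact (mul_le_of_le_one_left (v.nonneg _) (hv.apply_natCast_le_one)).trans
    (abv_coeff_le_coeffSup v P _)

theorem length_hasseDeriv_le [Fintype ι] [Nontrivial R] (v : AbsoluteValue R ℝ) {D : ι → ℕ}
    {P : MvPolynomial ι R} (hP : ∀ i, degreeOf i P ≤ D i) (e : ι →₀ ℕ) :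
    length v (hasseDeriv e P) ≤ 2 ^ (2 * ∑ i, D i) * coeffSup v P := by
  have hmem (s) (hs : s ∈ (hasseDeriv e P).support) : s + e ∈ P.support :=
    add_mem_support_of_mem_support_hasseDeriv hs
  have hcard : ((hasseDeriv e P).support.card : ℝ) ≤ 2 ^ ∑ i, D i := by
    exact_mod_cast (Finset.card_le_card_of_injOn (· + e) hmem
      fun _ _ _ _ h => add_right_cancel h).trans (card_support_le hP)
  have hterm (s) (hs : s ∈ (hasseDeriv e P).support) :
      v (coeff s (hasseDeriv e P)) ≤ 2 ^ (∑ i, D i) * coeffSup v P := by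
    have hchoose : ∏ i, (s i + e i).choose (e i) ≤ 2 ^ ∑ i, D i := by
      rw [← Finset.prod_pow_eq_pow_sum]
      exact Finset.prod_le_prod' fun i _ => (Nat.choose_le_two_pow _ _).trans
        (Nat.pow_le_pow_right two_pos (degreeOf_le_iff.1 (hP i) _ (hmem s hs)))
    rw [coeff_hasseDeriv, map_mul]
    refine mul_le_mul ((v.apply_nat_le_self _).trans ?_) (abv_coeff_le_coeffSup v P _)
      (v.nonneg _) (by positivity)
    exact_mod_cast hchoose
  calc length v (hasseDeriv e P)
      ≤ (hasseDeriv e P).support.card • (2 ^ (∑ i, D i) * coeffSup v P) :=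
        Finset.sum_le_card_nsmul _ _ _ hterm
    _ ≤ 2 ^ (∑ i, D i) * (2 ^ (∑ i, D i) * coeffSup v P) := by
        rw [nsmul_eq_mul]
        have := coeffSup_nonneg v P
        gcongr
    _ = 2 ^ (2 * ∑ i, D i) * coeffSup v P := by ring

end LocalBounds

section DetHeight

open Height AdmissibleAbsValues

variable {ι K : Type*} [Fintype ι] [Field K] [NumberField K]

theorem polyHeight_det_hasseDeriv_le {n : ℕ} {P : MvPolynomial ι K} {D : ι → ℕ}
    (hP : ∀ i, degreeOf i P ≤ D i) (hP0 : P ≠ 0) (e : Fin n → Fin n → ι →₀ ℕ)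
    (hdet : (Matrix.of fun i j => hasseDeriv (e i j) P).det ≠ 0) :
    polyHeight (Matrix.of fun i j => hasseDeriv (e i j) P).det ≤
      n * (polyHeight P + Real.log n + 2 * (∑ i, D i : ℕ) * Real.log 2) := by
  set A := Matrix.of fun i j => hasseDeriv (e i j) P
  set S := ∑ i, D i
  have harch (v : AbsoluteValue K ℝ) (s : A.det.support) :
      v (A.det.coeff s.1) ≤ n.factorial * (2 ^ (2 * S)) ^ n * coeffSup v P ^ n := by
    rw [mul_assoc, ← mul_pow]
    exact (abv_coeff_le_coeffSup v _ _).trans ((coeffSup_le_length v _).trans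
      (length_det_le v fun i j => length_hasseDeriv_le v hP (e i j)))
  have hnon (v) (hv : v ∈ nonarchAbsVal (K := K)) (s : A.det.support) :
      v (A.det.coeff s.1) ≤ coeffSup v P ^ n :=
    (abv_coeff_le_coeffSup v _ _).trans (coeffSup_det_le (isNonarchimedean v hv)
      (coeffSup_nonneg v P) fun i j => coeffSup_hasseDeriv_le (isNonarchimedean v hv) (e i j) P)
  have hfact : Real.log n.factorial ≤ n * Real.log n := by
    rw [← Real.log_pow]
    exact Real.log_le_log (mod_cast n.factorial_pos) (mod_cast n.factorial_le_pow)
  have hlog : Real.log (n.factorial * (2 ^ (2 * S)) ^ n) =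
      Real.log n.factorial + n * (2 * S * Real.log 2) := by
    rw [Real.log_mul (mod_cast n.factorial_ne_zero) (by positivity), Real.log_pow, Real.log_pow]
    push_cast
    ring
  calc polyHeight A.det
      ≤ Real.log (n.factorial * (2 ^ (2 * S)) ^ n) + n * polyHeight P :=
        absHeight_le_of_local (coeff_restrict_support_ne_zero hdet)
          (coeff_restrict_support_ne_zero hP0) n (by positivity) (fun v _ => harch v) hnon
    _ ≤ n * (polyHeight P + Real.log n + 2 * S * Real.log 2) := by
        rw [hlog]
        linarith

end DetHeight

section LinearFactor

open Polynomial (natDegree rootMultiplicity)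

variable {R : Type*} [CommRing R]

theorem coeff_X_sub_C_mul_succ (ξ : R) (r : Polynomial R) (j : ℕ) :
    ((Polynomial.X - Polynomial.C ξ) * r).coeff (j + 1) = r.coeff j - ξ * r.coeff (j + 1) := by
  rw [sub_mul, Polynomial.coeff_sub, Polynomial.coeff_X_mul, Polynomial.coeff_C_mul]

variable {v : AbsoluteValue R ℝ} {ξ : R} {r : Polynomial R} {B : ℝ}

theorem abv_coeff_mul_le_sum (hξ : 1 ≤ v ξ) (r : Polynomial R) (j : ℕ) :
    v (r.coeff j) * v ξ ≤
      ∑ i ∈ Finset.range (j + 1), v (((Polynomial.X - Polynomial.C ξ) * r).coeff i) := by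
  induction j with
  | zero => simp [mul_comm]
  | succ j ih =>
    have hstep : v (r.coeff (j + 1)) * v ξ ≤ v (r.coeff j) +
        v (((Polynomial.X - Polynomial.C ξ) * r).coeff (j + 1)) := by
      rw [← map_mul, mul_comm, coeff_X_sub_C_mul_succ]
      have hsub := v.sub_le (r.coeff j) 0 (r.coeff j - ξ * r.coeff (j + 1))
      rwa [sub_zero, sub_sub_cancel, zero_sub, v.map_neg] at hsub
    rw [Finset.sum_range_succ]
    linarith [le_mul_of_one_le_right (v.nonneg (r.coeff j)) hξ]

theorem abv_coeff_mul_pow_le [Nontrivial R] (hξ : 1 ≤ v ξ) (l : ℕ)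
    (hB : ∀ i, v (((Polynomial.X - Polynomial.C ξ) ^ l * r).coeff i) ≤ B) (j : ℕ) :
    v (r.coeff j) * v ξ ^ l ≤ (j + l).choose l * B := by
  induction l generalizing r j with
  | zero => simpa using hB j
  | succ l ih =>
    have ih' := ih (r := (Polynomial.X - Polynomial.C ξ) * r) fun i => by
      rw [← mul_assoc, ← pow_succ]
      exact hB i
    calc v (r.coeff j) * v ξ ^ (l + 1) = v (r.coeff j) * v ξ * v ξ ^ l := by ring
      _ ≤ (∑ i ∈ Finset.range (j + 1),
            v (((Polynomial.X - Polynomial.C ξ) * r).coeff i)) * v ξ ^ l := by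
          gcongr
          exact abv_coeff_mul_le_sum hξ r j
      _ ≤ ∑ i ∈ Finset.range (j + 1), (i + l).choose l * B := by
          rw [Finset.sum_mul]
          exact Finset.sum_le_sum fun i _ => ih' i
      _ = (j + (l + 1)).choose (l + 1) * B := by
          rw [← Finset.sum_mul, ← Nat.cast_sum, Nat.sum_range_add_choose, add_assoc]

theorem abv_coeff_mul_le_of_isNonarchimedean (hv : IsNonarchimedean v) (hξ : 1 ≤ v ξ)
    (hB : ∀ i, v (((Polynomial.X - Polynomial.C ξ) * r).coeff i) ≤ B) (j : ℕ) :
    v (r.coeff j) * v ξ ≤ B := by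
  induction j with
  | zero => simpa [sub_mul, mul_comm] using hB 0
  | succ j ih =>
    have hj : v (r.coeff j) ≤ B := (le_mul_of_one_le_right (v.nonneg _) hξ).trans ih
    have hsucc := hB (j + 1)
    rw [coeff_X_sub_C_mul_succ] at hsucc
    have hsub := (hv (r.coeff j) (-(r.coeff j - ξ * r.coeff (j + 1)))).trans
      (max_le hj (by rwa [v.map_neg]))
    rwa [neg_sub, add_sub_cancel, map_mul, mul_comm] at hsub

theorem abv_coeff_mul_pow_le_of_isNonarchimedean [Nontrivial R] (hv : IsNonarchimedean v)
    (hξ : 1 ≤ v ξ) (l : ℕ)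
    (hB : ∀ i, v (((Polynomial.X - Polynomial.C ξ) ^ l * r).coeff i) ≤ B) (j : ℕ) :
    v (r.coeff j) * v ξ ^ l ≤ B := by
  induction l generalizing r j with
  | zero => simpa using hB j
  | succ l ih =>
    have hpow : 0 < v ξ ^ l := pow_pos (zero_lt_one.trans_le hξ) l
    have hdiv (i : ℕ) : v (((Polynomial.X - Polynomial.C ξ) * r).coeff i) ≤ B / v ξ ^ l := by
      refine (le_div_iff₀ hpow).2 (ih (fun i => ?_) i)
      rw [← mul_assoc, ← pow_succ]
      exact hB i
    rw [pow_succ', ← mul_assoc, ← le_div_iff₀ hpow]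
    exact abv_coeff_mul_le_of_isNonarchimedean hv hξ hdiv j

variable [IsDomain R] {q : Polynomial R}

theorem exists_eq_X_sub_C_pow_rootMultiplicity_mul (ξ : R) (hq : q ≠ 0) :
    ∃ r : Polynomial R, q = (Polynomial.X - Polynomial.C ξ) ^ rootMultiplicity ξ q * r ∧
      r.leadingCoeff = q.leadingCoeff ∧ r.natDegree + rootMultiplicity ξ q = q.natDegree := by
  obtain ⟨r, hr⟩ := Polynomial.pow_rootMultiplicity_dvd q ξ
  have hr0 : r ≠ 0 := by
    rintro rfl
    exact hq (by rw [hr, mul_zero])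
  refine ⟨r, hr, ?_, ?_⟩
  · conv_rhs => rw [hr]
    simp
  · conv_rhs => rw [hr]
    rw [Polynomial.natDegree_mul (pow_ne_zero _ (Polynomial.X_sub_C_ne_zero _)) hr0]
    simp [add_comm]

theorem abv_leadingCoeff_mul_pow_le (hq : q ≠ 0) (hB : ∀ i, v (q.coeff i) ≤ B) :
    v q.leadingCoeff * v ξ ^ rootMultiplicity ξ q ≤ 2 ^ q.natDegree * B := by
  have hB0 : 0 ≤ B := (v.nonneg _).trans (hB 0)
  rcases le_total (v ξ) 1 with hξ | hξ
  · calc v q.leadingCoeff * v ξ ^ rootMultiplicity ξ q ≤ v q.leadingCoeff :=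
          mul_le_of_le_one_right (v.nonneg _) (pow_le_one₀ (v.nonneg _) hξ)
      _ ≤ B := hB _
      _ ≤ 2 ^ q.natDegree * B := le_mul_of_one_le_left hB0 (one_le_pow₀ one_le_two)
  · obtain ⟨r, hr, hlead, hdeg⟩ := exists_eq_X_sub_C_pow_rootMultiplicity_mul ξ hq
    have hchoose : q.natDegree.choose (rootMultiplicity ξ q) ≤ 2 ^ q.natDegree :=
      Nat.choose_le_two_pow _ _
    have hbound := abv_coeff_mul_pow_le (r := r) hξ _ (fun i => by rw [← hr]; exact hB i)
      r.natDegree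
    rw [hdeg, Polynomial.coeff_natDegree, hlead] at hbound
    exact hbound.trans (mul_le_mul_of_nonneg_right (mod_cast hchoose) hB0)

theorem abv_leadingCoeff_mul_pow_le_of_isNonarchimedean (hv : IsNonarchimedean v) (hq : q ≠ 0)
    (hB : ∀ i, v (q.coeff i) ≤ B) :
    v q.leadingCoeff * v ξ ^ rootMultiplicity ξ q ≤ B := by
  rcases le_total (v ξ) 1 with hξ | hξ
  · exact (mul_le_of_le_one_right (v.nonneg _) (pow_le_one₀ (v.nonneg _) hξ)).trans (hB _)
  · obtain ⟨r, hr, hlead, -⟩ := exists_eq_X_sub_C_pow_rootMultiplicity_mul ξ hq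
    have hbound := abv_coeff_mul_pow_le_of_isNonarchimedean (r := r) hv hξ _
      (fun i => by rw [← hr]; exact hB i) r.natDegree
    rwa [Polynomial.coeff_natDegree, hlead] at hbound

end LinearFactor

section Univariate

open Height AdmissibleAbsValues
open Polynomial (natDegree rootMultiplicity)

variable {ι R : Type*} [CommRing R]

theorem coeff_single_aeval_X (j : ι) (q : Polynomial R) (k : ℕ) :
    coeff (Finsupp.single j k) (Polynomial.aeval (X j : MvPolynomial ι R) q) = q.coeff k := by
  classical
  induction q using Polynomial.induction_on' with
  | add p q hp hq => rw [map_add, coeff_add, hp, hq, Polynomial.coeff_add]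
  | monomial n a =>
    rw [Polynomial.aeval_monomial, algebraMap_eq, coeff_C_mul, coeff_X_pow,
      Polynomial.coeff_monomial]
    simp [(Finsupp.single_injective j).eq_iff]

theorem exists_aeval_X_eq {f : MvPolynomial ι R} {j : ι} (hf : f.vars ⊆ {j}) :
    ∃ q : Polynomial R, Polynomial.aeval (X j) q = f := by
  have hmem : f ∈ supported R {j} := mem_supported.2 (mod_cast hf)
  rwa [supported_eq_adjoin_X, Set.image_singleton, Algebra.adjoin_singleton_eq_range_aeval] at hmem

theorem natDegree_le_degreeOf_aeval_X (j : ι) {q : Polynomial R} (hq : q ≠ 0) :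
    natDegree q ≤ degreeOf j (Polynomial.aeval (X j : MvPolynomial ι R) q) := by
  have hmem : Finsupp.single j (natDegree q) ∈
      (Polynomial.aeval (X j : MvPolynomial ι R) q).support := by
    rw [mem_support_iff, coeff_single_aeval_X]
    exact Polynomial.leadingCoeff_ne_zero.2 hq
  simpa using le_degreeOf_of_mem_support j hmem

theorem translate_aeval_X (ξ : ι → R) (j : ι) (q : Polynomial R) :
    translate ξ (Polynomial.aeval (X j) q) =
      Polynomial.aeval (X j) (q.comp (Polynomial.X + Polynomial.C (ξ j))) := by
  rw [Polynomial.aeval_comp, ← Polynomial.aeval_algHom_apply]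
  simp

theorem mul_le_rootMultiplicity_of_translate_mem_orderIdeal {d : ι → ℕ} {j : ι} (hd : 0 < d j)
    {ξ : ι → R} {q : Polynomial R} (hq : q ≠ 0) {t : ℝ}
    (h : translate ξ (Polynomial.aeval (X j) q) ∈ orderIdeal d t) :
    t * d j ≤ rootMultiplicity (ξ j) q := by
  set T := q.comp (Polynomial.X + Polynomial.C (ξ j))
  have hcoeff : T.coeff (rootMultiplicity (ξ j) q) ≠ 0 := by
    rw [Polynomial.rootMultiplicity_eq_natTrailingDegree]
    exact Polynomial.trailingCoeff_nonzero_iff_nonzero.2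
      (Polynomial.comp_X_add_C_ne_zero_iff.2 hq)
  rw [translate_aeval_X, ← coeff_single_aeval_X j] at *
  have hweight := mem_orderIdeal_iff.1 h _ hcoeff
  rw [weight_apply, Finsupp.sum_single_index (by simp), ← div_eq_mul_inv] at hweight
  exact (le_div_iff₀ (mod_cast hd)).1 hweight

variable {ι K : Type*} [Field K] [NumberField K]

theorem absHeight_pow_one (ξ : K) (l : ℕ) :
    absHeight ![ξ ^ l, 1] = l * absHeight ![ξ, 1] := by
  rw [absHeight, absHeight, ← logHeight₁_eq_logHeight, ← logHeight₁_eq_logHeight, logHeight₁_pow,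
    mul_div_assoc]

theorem rootMultiplicity_mul_absHeight_le (j : ι) (ξ : K) {q : Polynomial K} (hq : q ≠ 0) :
    rootMultiplicity ξ q * absHeight ![ξ, 1] ≤
      polyHeight (Polynomial.aeval (X j : MvPolynomial ι K) q) + natDegree q * Real.log 2 := by
  set f := Polynomial.aeval (X j : MvPolynomial ι K) q
  set l := rootMultiplicity ξ q
  have hf0 : f ≠ 0 := fun h => hq (Polynomial.ext fun k => by
    rw [← coeff_single_aeval_X j q k, ← coeff_single_aeval_X j 0 k, map_zero]
    exact congrArg _ h)
  have ha0 : q.leadingCoeff ≠ 0 := Polynomial.leadingCoeff_ne_zero.2 hq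
  have hx0 : q.leadingCoeff • ![ξ ^ l, 1] ≠ 0 := fun h => ha0 (by simpa using congrFun h 1)
  have hcoeff (v : AbsoluteValue K ℝ) (k : ℕ) : v (q.coeff k) ≤ coeffSup v f := by
    rw [← coeff_single_aeval_X j]
    exact abv_coeff_le_coeffSup v f _
  have hlead (v : AbsoluteValue K ℝ) : v q.leadingCoeff ≤ coeffSup v f := hcoeff v _
  have harch (v : AbsoluteValue K ℝ) (i : Fin 2) :
      v ((q.leadingCoeff • ![ξ ^ l, 1]) i) ≤ 2 ^ natDegree q * coeffSup v f ^ 1 := by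
    rw [pow_one]
    fin_cases i
    · simpa using abv_leadingCoeff_mul_pow_le hq (hcoeff v)
    · simpa using (hlead v).trans
        (le_mul_of_one_le_left (coeffSup_nonneg v f) (one_le_pow₀ one_le_two))
  have hnon (v) (hv : v ∈ nonarchAbsVal (K := K)) (i : Fin 2) :
      v ((q.leadingCoeff • ![ξ ^ l, 1]) i) ≤ coeffSup v f ^ 1 := by
    rw [pow_one]
    fin_cases i
    · simpa using
        abv_leadingCoeff_mul_pow_le_of_isNonarchimedean (isNonarchimedean v hv) hq (hcoeff v)
    · simpa using hlead v
  have hle := absHeight_le_of_local hx0 (coeff_restrict_support_ne_zero hf0) 1 (by positivity)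
    (fun v _ => harch v) hnon
  rw [absHeight_smul _ ha0, absHeight_pow_one, Real.log_pow, Nat.cast_one, one_mul,
    add_comm] at hle
  exact hle

theorem order_mul_absHeight_le {d : ι → ℕ} {j : ι} (hd : 0 < d j) {f : MvPolynomial ι K}
    (hf : f.vars ⊆ {j}) (hf0 : f ≠ 0) {ξ : ι → K} {t : ℝ}
    (h : translate ξ f ∈ orderIdeal d t) :
    t * (d j * absHeight ![ξ j, 1]) ≤ polyHeight f + degreeOf j f * Real.log 2 := by
  obtain ⟨q, rfl⟩ := exists_aeval_X_eq hf
  have hq : q ≠ 0 := by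
    rintro rfl
    exact hf0 (map_zero _)
  calc t * (d j * absHeight ![ξ j, 1]) = t * d j * absHeight ![ξ j, 1] := by ring
    _ ≤ rootMultiplicity (ξ j) q * absHeight ![ξ j, 1] :=
        mul_le_mul_of_nonneg_right (mul_le_rootMultiplicity_of_translate_mem_orderIdeal hd hq h)
          (absHeight_nonneg _)
    _ ≤ _ := rootMultiplicity_mul_absHeight_le j (ξ j) hq
    _ ≤ _ := by
        have hdeg := natDegree_le_degreeOf_aeval_X j hq
        gcongr

end Univariate

section Decomposition

theorem exists_eq_sum_mul_of_not_linearIndependent {K R : Type*} [Field K] [CommRing R]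
    [Algebra K R] (A B : Submodule K R) {n : ℕ} {f g : Fin (n + 1) → R} (hf : ∀ i, f i ∈ A)
    (hg : ∀ i, g i ∈ B) (hdep : ¬ LinearIndependent K f) :
    ∃ f' g' : Fin n → R, (∀ i, f' i ∈ A) ∧ (∀ i, g' i ∈ B) ∧ ∑ i, f' i * g' i = ∑ i, f i * g i := by
  obtain ⟨w, hw, i, hi⟩ := Fintype.not_linearIndependent_iff.1 hdep
  rw [Fin.sum_univ_succAbove _ i, add_eq_zero_iff_eq_neg, ← Finset.sum_neg_distrib] at hw
  have hfi : f i = ∑ k, (-(w i)⁻¹ * w (i.succAbove k)) • f (i.succAbove k) := by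
    rw [← inv_smul_smul₀ hi (f i), hw, Finset.smul_sum]
    exact Finset.sum_congr rfl fun k _ => by rw [← neg_smul, smul_smul, neg_mul, mul_neg]
  refine ⟨fun k => f (i.succAbove k),
    fun k => g (i.succAbove k) + (-(w i)⁻¹ * w (i.succAbove k)) • g i, fun k => hf _,
    fun k => B.add_mem (hg _) (B.smul_mem _ (hg i)), ?_⟩
  rw [Fin.sum_univ_succAbove _ i, hfi, Finset.sum_mul, ← Finset.sum_add_distrib]
  refine Finset.sum_congr rfl fun k _ => ?_
  rw [mul_add, mul_smul_comm, smul_mul_assoc, add_comm]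

theorem exists_eq_sum_mul_linearIndependent {K R : Type*} [Field K] [CommRing R] [Algebra K R]
    (A B : Submodule K R) {N : ℕ} (f g : Fin N → R) (hf : ∀ i, f i ∈ A) (hg : ∀ i, g i ∈ B) :
    ∃ n ≤ N, ∃ f' g' : Fin n → R, (∀ i, f' i ∈ A) ∧ (∀ i, g' i ∈ B) ∧
      LinearIndependent K f' ∧ LinearIndependent K g' ∧ ∑ i, f' i * g' i = ∑ i, f i * g i := by
  induction N with
  | zero => exact ⟨0, le_rfl, f, g, hf, hg, linearIndependent_empty_type,
      linearIndependent_empty_type, rfl⟩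
  | succ N ih =>
    by_cases hfi : LinearIndependent K f
    · by_cases hgi : LinearIndependent K g
      · exact ⟨N + 1, le_rfl, f, g, hf, hg, hfi, hgi, rfl⟩
      obtain ⟨g', f', hg', hf', hsum⟩ :=
        exists_eq_sum_mul_of_not_linearIndependent B A hg hf hgi
      obtain ⟨n, hn, f'', g'', hf'', hg'', hfi'', hgi'', hsum'⟩ := ih f' g' hf' hg'
      refine ⟨n, hn.trans N.le_succ, f'', g'', hf'', hg'', hfi'', hgi'', hsum'.trans ?_⟩
      simpa only [mul_comm] using hsum
    · obtain ⟨f', g', hf', hg', hsum⟩ :=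
        exists_eq_sum_mul_of_not_linearIndependent A B hf hg hfi
      obtain ⟨n, hn, f'', g'', hf'', hg'', hfi'', hgi'', hsum'⟩ := ih f' g' hf' hg'
      exact ⟨n, hn.trans N.le_succ, f'', g'', hf'', hg'', hfi'', hgi'', hsum'.trans hsum⟩

variable {ι K : Type*} [Field K]

theorem exists_eq_sum_mul_X_pow (P : MvPolynomial ι K) (j : ι) :
    ∃ p : Fin (degreeOf j P + 1) → MvPolynomial ι K,
      (∀ c, ∀ s ∈ (p c).support, s j = 0 ∧ ∀ i, s i ≤ degreeOf i P) ∧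
      P = ∑ c, p c * X j ^ (c : ℕ) := by
  classical
  refine ⟨fun c : Fin (degreeOf j P + 1) => ∑ s ∈ P.support with s j = (c : ℕ),
    monomial (s.erase j) (coeff s P), fun c r hr => ?_, ?_⟩
  · obtain ⟨s, hs, hne⟩ := Finset.exists_ne_zero_of_sum_ne_zero
      (by rwa [mem_support_iff, coeff_sum] at hr)
    obtain rfl : s.erase j = r := by_contra fun h => hne (by rw [coeff_monomial, if_neg h])
    refine ⟨Finsupp.erase_same, fun i => le_trans ?_
      (monomial_le_degreeOf i (Finset.mem_filter.1 hs).1)⟩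
    rw [Finsupp.erase_apply]
    split_ifs <;> simp
  · conv_lhs => rw [P.as_sum]
    rw [← Finset.sum_fiberwise_of_maps_to (t := Finset.univ)
      (g := fun s => Fin.ofNat (degreeOf j P + 1) (s j)) fun _ _ => Finset.mem_univ _]
    refine Finset.sum_congr rfl fun c _ => ?_
    rw [Finset.sum_mul]
    refine Finset.sum_congr (Finset.filter_congr fun s hs => ?_) fun s hs => ?_
    · rw [Fin.ext_iff, Fin.val_ofNat,
        Nat.mod_eq_of_lt (Nat.lt_succ_of_le (le_degreeOf_of_mem_support j hs))]
    · rw [← (Finset.mem_filter.1 hs).2, X_pow_eq_monomial, monomial_mul, mul_one,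
        Finsupp.erase_add_single]

theorem exists_eq_sum_mul_separating [DecidableEq ι] (P : MvPolynomial ι K) (j : ι) :
    ∃ n ≤ degreeOf j P + 1, ∃ f g : Fin n → MvPolynomial ι K,
      ((∀ a, (f a).vars ⊆ P.vars.erase j) ∧ ∀ a i, degreeOf i (f a) ≤ degreeOf i P) ∧
      ((∀ a, (g a).vars ⊆ {j}) ∧ ∀ a i, degreeOf i (g a) ≤ degreeOf i P) ∧
      LinearIndependent K f ∧ LinearIndependent K g ∧ ∑ a, f a * g a = P := by
  obtain ⟨p, hp, hP⟩ := exists_eq_sum_mul_X_pow P j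
  let A := restrictSupport K {s : ι →₀ ℕ | s j = 0 ∧ ∀ i, s i ≤ degreeOf i P}
  let B := restrictSupport K {s : ι →₀ ℕ | (∀ i ≠ j, s i = 0) ∧ ∀ i, s i ≤ degreeOf i P}
  have hX (c : Fin (degreeOf j P + 1)) : X j ^ (c : ℕ) ∈ B := by
    rw [X_pow_eq_monomial]
    refine (monomial_mem_restrictSupport K).2 (.inl ⟨fun i hi => Finsupp.single_eq_of_ne hi,
      fun i => ?_⟩)
    obtain rfl | hi := eq_or_ne i j
    · simpa using Nat.le_of_lt_succ c.2
    · simp [Finsupp.single_eq_of_ne hi]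
  obtain ⟨n, hn, f, g, hf, hg, hfi, hgi, hsum⟩ :=
    exists_eq_sum_mul_linearIndependent A B p (fun c => X j ^ (c : ℕ)) hp hX
  refine ⟨n, hn, f, g, ⟨fun a i hi => ?_, fun a i => ?_⟩, ⟨fun a i hi => ?_, fun a i => ?_⟩, hfi,
    hgi, hsum.trans hP.symm⟩
  · obtain ⟨s, hs, his⟩ := (mem_vars_iff_mem_support i).1 hi
    rw [Finsupp.mem_support_iff] at his
    refine Finset.mem_erase.2 ⟨fun hij => his (hij ▸ (hf a hs).1), ?_⟩
    exact mem_vars_iff_degreeOf_ne_zero.2 fun h => his (Nat.le_zero.1 (h ▸ (hf a hs).2 i))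
  · exact degreeOf_le_iff.2 fun s hs => (hf a hs).2 i
  · obtain ⟨s, hs, his⟩ := (mem_vars_iff_mem_support i).1 hi
    by_contra hij
    exact Finsupp.mem_support_iff.1 his ((hg a hs).1 i (mt Finset.mem_singleton.2 hij))
  · exact degreeOf_le_iff.2 fun s hs => (hg a hs).2 i

end Decomposition

section RealInequalities

/- The trapezoidal rule for `∫ p dp`: consecutive terms satisfy
`d * (p i ^ 2 - p (i + 1) ^ 2) ≤ p i + p (i + 1)`. -/
theorem half_add_sq_sub_sq_le_sum {p : ℕ → ℝ} {d : ℝ} (hp : ∀ i, 0 ≤ p i)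
    (hstep : ∀ i, d * (p i - p (i + 1)) ≤ 1) (N : ℕ) :
    (p 0 + p N) / 2 + d * (p 0 ^ 2 - p N ^ 2) / 2 ≤ ∑ i ∈ Finset.range (N + 1), p i := by
  induction N with
  | zero => simp
  | succ N ih =>
    rw [Finset.sum_range_succ]
    nlinarith [mul_le_mul_of_nonneg_right (hstep N) (add_nonneg (hp N) (hp (N + 1)))]

theorem mul_min_sq_le_sum_max_sub_div {Θ : ℝ} (hΘ : 0 ≤ Θ) {d n : ℕ} (hd : 0 < d)
    (hnd : n ≤ d + 1) :
    (n : ℝ) * (min Θ (Θ ^ 2) / 2) ≤ ∑ i : Fin n, max (Θ - (i : ℕ) / d) 0 := by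
  obtain _ | N := n
  · simp
  set p : ℕ → ℝ := fun i => max (Θ - i / d) 0
  have hd' : (0 : ℝ) < d := mod_cast hd
  have hstep (i : ℕ) : d * (p i - p (i + 1)) ≤ 1 := by
    have hsub : p i - p (i + 1) ≤ 1 / d := by
      refine sub_le_iff_le_add.2 (max_le ?_ (by positivity))
      have hle : Θ - (i + 1 : ℕ) / d ≤ p (i + 1) := le_max_left _ _
      rw [Nat.cast_succ, add_div] at hle
      linarith
    rwa [le_div_iff₀' hd'] at hsub
  have hp0 : p 0 = Θ := by simp [p, hΘ]
  have htrapezoid := half_add_sq_sub_sq_le_sum (p := p) (fun i => le_max_right _ _) hstep N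
  rw [Fin.sum_univ_eq_sum_range p]
  refine le_trans ?_ htrapezoid
  rw [hp0]
  rcases le_total (Θ - N / d) 0 with hN | hN
  · have hpN : p N = 0 := max_eq_right hN
    have hnd' : ((N + 1 : ℕ) : ℝ) ≤ d + 1 := mod_cast hnd
    have hΘ1 : Θ ≤ 1 := by
      refine (sub_nonpos.1 hN).trans ((div_le_one hd').2 ?_)
      exact_mod_cast Nat.le_of_succ_le_succ hnd
    rw [hpN]
    nlinarith [min_le_right Θ (Θ ^ 2), mul_nonneg hΘ hΘ]
  · have hpN : d * p N = d * Θ - N := by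
      simp only [p, max_eq_left hN]
      field_simp
    have hpN0 : 0 ≤ p N := le_max_right _ _
    push_cast
    nlinarith [min_le_left Θ (Θ ^ 2)]

theorem le_two_mul_of_min_sq_le {Θ ρ k : ℝ} (hk : 1 ≤ k) (hΘ : Θ ≤ k) (hρ : 0 < ρ)
    (h : min Θ (Θ ^ 2) ≤ 4 * k * ρ ^ 2) : Θ ≤ 2 * k * ρ := by
  rcases min_le_iff.1 h with h | h
  · rcases le_total ρ (1 / 2) with hρ' | hρ'
    · nlinarith [mul_le_mul_of_nonneg_left hρ' (by positivity : 0 ≤ k * ρ)]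
    · nlinarith
  · refine (le_abs_self Θ).trans (abs_le_of_sq_le_sq (h.trans ?_) (by positivity))
    nlinarith [mul_le_mul_of_nonneg_left hk (by positivity : 0 ≤ k * ρ ^ 2)]

end RealInequalities

section Wronskian

variable {ι : Type*}

theorem weight_le_degree_mul {d : ι → ℕ} {c : ℝ} {s : ι →₀ ℕ}
    (h : ∀ i ∈ s.support, (d i : ℝ)⁻¹ ≤ c) : weight d s ≤ s.degree * c := by
  rw [weight_apply, Finsupp.degree_apply, Nat.cast_sum, Finset.sum_mul]
  exact Finset.sum_le_sum fun i hi => mul_le_mul_of_nonneg_left (h i hi) (Nat.cast_nonneg _)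

theorem weight_le_div_of_support_subset {d : ι → ℕ} {j : ι} {s : ι →₀ ℕ} (hs : s.support ⊆ {j})
    {n : ℕ} (hn : s.degree ≤ n) : weight d s ≤ n / d j := by
  refine (weight_le_degree_mul fun i hi => ?_).trans
    (mul_le_mul_of_nonneg_right (Nat.cast_le.2 hn) (inv_nonneg.2 (d j).cast_nonneg))
  rw [Finset.mem_singleton.1 (hs hi)]

theorem weight_le_of_degree_le {d : ι → ℕ} {j : ι} (hd : 0 < d j) {σ : ℝ} (hσ : 0 ≤ σ)
    {s : ι →₀ ℕ} (hs : ∀ i ∈ s.support, (d j : ℝ) ≤ σ * d i) (hdeg : s.degree ≤ d j) :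
    weight d s ≤ σ := by
  have hd' : (0 : ℝ) < d j := mod_cast hd
  refine (weight_le_degree_mul (c := σ / d j) fun i hi => ?_).trans ?_
  · have hi' : (0 : ℝ) < d i := pos_of_mul_pos_right (hd'.trans_le (hs i hi)) hσ
    rw [inv_le_iff_one_le_mul₀ hi', div_mul_eq_mul_div, one_le_div hd']
    exact hs i hi
  · rw [mul_div_left_comm]
    exact mul_le_of_le_one_right hσ ((div_le_one hd').2 (mod_cast hdeg))

variable [Fintype ι]

section Det

variable {R : Type*} [CommRing R] {n : ℕ} {f g : Fin n → MvPolynomial ι R}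
  {e e' : Fin n → ι →₀ ℕ} {j : ι}

theorem degreeOf_det_hasseDeriv_le {D : ℕ} (hf : ∀ a, degreeOf j (f a) ≤ D) :
    degreeOf j (Matrix.of fun i a => hasseDeriv (e i) (f a)).det ≤ n * D :=
  degreeOf_det_le fun i a => (degreeOf_hasseDeriv_le (e i) j (f a)).trans (hf a)

theorem vars_det_hasseDeriv_subset {S : Finset ι} (hf : ∀ a, (f a).vars ⊆ S) :
    (Matrix.of fun i a => hasseDeriv (e i) (f a)).det.vars ⊆ S :=
  vars_subset_iff_degreeOf.2 fun j hj => Nat.le_zero.1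
    (degreeOf_det_hasseDeriv_le fun a => (vars_subset_iff_degreeOf.1 (hf a) j hj).le)

theorem support_subset_of_det_hasseDeriv_ne_zero
    (hdet : (Matrix.of fun i a => hasseDeriv (e i) (f a)).det ≠ 0) {S : Finset ι}
    (hf : ∀ a, (f a).vars ⊆ S) (i : Fin n) : (e i).support ⊆ S := by
  intro j hj
  by_contra hjS
  refine hdet (Matrix.det_eq_zero_of_row_eq_zero i fun a => ?_)
  refine hasseDeriv_eq_zero_of_degreeOf_lt (i := j) ?_
  rw [vars_subset_iff_degreeOf.1 (hf a) j hjS]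
  exact Nat.pos_of_ne_zero (Finsupp.mem_support_iff.1 hj)

theorem det_hasseDeriv_sum_mul {S : Finset ι} (hf : ∀ a, Disjoint (f a).vars S)
    (he : ∀ i, Disjoint (e i).support S) (hg : ∀ a, (g a).vars ⊆ S)
    (he' : ∀ i, (e' i).support ⊆ S) :
    (Matrix.of fun i c => hasseDeriv (e i + e' c) (∑ a, f a * g a)).det =
      (Matrix.of fun i a => hasseDeriv (e i) (f a)).det *
        (Matrix.of fun i a => hasseDeriv (e' i) (g a)).det := by
  rw [← Matrix.det_transpose (Matrix.of fun i a => hasseDeriv (e' i) (g a)), ← Matrix.det_mul]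
  congr 1
  ext1 i c
  rw [Matrix.mul_apply, Matrix.of_apply, map_sum]
  exact Finset.sum_congr rfl fun a _ =>
    hasseDeriv_mul_of_disjoint (hf a) (he i) (hg a) (he' c)

theorem translate_det_hasseDeriv_mem_orderIdeal [IsDomain R] [CharZero R] {P : MvPolynomial ι R}
    {d : ι → ℕ} {ξ : ι → R} {t σ : ℝ} (hP : translate ξ P ∈ orderIdeal d t) (ht : 0 ≤ t)
    (hd : 0 < d j) (hn : n ≤ d j + 1) (he : ∀ i, weight d (e i) ≤ σ)
    (he' : ∀ i, weight d (e' i) ≤ (i : ℕ) / d j) :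
    translate ξ (Matrix.of fun i c => hasseDeriv (e i + e' c) P).det ∈
      orderIdeal d (n * (min t (t ^ 2) / 2 - σ)) := by
  have hentry (i c : Fin n) : translate ξ (hasseDeriv (e i + e' c) P) ∈
      orderIdeal d (max (t - (c : ℕ) / d j) 0 - σ) := by
    have hle := he i
    have hle' := he' c
    have hσ : 0 ≤ σ := (weight_nonneg d (e i)).trans hle
    rcases le_total (t - (c : ℕ) / d j) 0 with hneg | hpos
    · exact mem_orderIdeal_of_nonpos d (by rw [max_eq_right hneg]; linarith) _
    · rw [← hasseDeriv_translate, max_eq_left hpos]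
      refine fun s hs => le_trans ?_ (hasseDeriv_mem_orderIdeal hP (e i + e' c) s hs)
      rw [map_add]
      linarith
  have hdet := det_mem_orderIdeal
    (A := (translate ξ).mapMatrix (Matrix.of fun i c => hasseDeriv (e i + e' c) P)) hentry
  rw [← AlgHom.map_det, Finset.sum_sub_distrib, Fin.sum_const, nsmul_eq_mul] at hdet
  refine fun s hs => le_trans ?_ (hdet s hs)
  rw [mul_sub]
  exact sub_le_sub_right (mul_min_sq_le_sum_max_sub_div ht hd hn) _

end Det

variable {K : Type*} [Field K] [NumberField K]

/- A Wronskian determinant of `P` in which the rows differentiate in the variables other than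
`X j`, and the columns in `X j`. Since `P` is a sum of products that separate `X j` from the other
variables, it factors in the same way. -/
theorem exists_wronskian_factors [DecidableEq ι] {P : MvPolynomial ι K} (hP0 : P ≠ 0) {j : ι}
    {d : ι → ℕ} (hd : 0 < d j) (hPd : degreeOf j P ≤ d j) {σ : ℝ} (hσ : 0 ≤ σ)
    (hdσ : ∀ i ∈ P.vars, i ≠ j → (d j : ℝ) ≤ σ * d i) {ξ : ι → K} {t : ℝ} (ht : 0 ≤ t)
    (hP : translate ξ P ∈ orderIdeal d t) :
    ∃ (n : ℕ) (U V : MvPolynomial ι K), 0 < n ∧ n ≤ degreeOf j P + 1 ∧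
      (U ≠ 0 ∧ U.vars ⊆ P.vars.erase j ∧ ∀ i, degreeOf i U ≤ n * degreeOf i P) ∧
      (V ≠ 0 ∧ V.vars ⊆ {j} ∧ degreeOf j V ≤ n * degreeOf j P) ∧
      polyHeight U + polyHeight V ≤
        n * (polyHeight P + Real.log n + 2 * (∑ i, degreeOf i P : ℕ) * Real.log 2) ∧
      translate ξ (U * V) ∈ orderIdeal d (n * (min t (t ^ 2) / 2 - σ)) := by
  obtain ⟨n, hn, f, g, ⟨hfv, hfP⟩, ⟨hgv, hgP⟩, hf, hg, hsum⟩ := exists_eq_sum_mul_separating P j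
  obtain ⟨e, he, hU⟩ := exists_det_hasseDeriv_ne_zero n f hf
  obtain ⟨e', he', hV⟩ := exists_det_hasseDeriv_ne_zero n g hg
  have hn0 : 0 < n := Nat.pos_of_ne_zero fun h => by
    subst h
    exact hP0 (by rw [← hsum, Fin.sum_univ_zero])
  have heP := support_subset_of_det_hasseDeriv_ne_zero hU hfv
  have he'j := support_subset_of_det_hasseDeriv_ne_zero hV hgv
  have hUv := vars_det_hasseDeriv_subset (e := e) hfv
  have hVv := vars_det_hasseDeriv_subset (e := e') hgv
  have hdisj {s : Finset ι} (hs : s ⊆ P.vars.erase j) : Disjoint s {j} :=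
    Finset.disjoint_singleton_right.2 fun h => Finset.notMem_erase j _ (hs h)
  have hdet := det_hasseDeriv_sum_mul (fun a => hdisj (hfv a)) (fun i => hdisj (heP i)) hgv he'j
  rw [hsum] at hdet
  refine ⟨n, _, _, hn0, hn, ⟨hU, hUv, fun i => degreeOf_det_hasseDeriv_le fun a => hfP a i⟩,
    ⟨hV, hVv, degreeOf_det_hasseDeriv_le fun a => hgP a j⟩, ?_, ?_⟩
  · refine (polyHeight_add_le_of_disjoint_vars ((hdisj hUv).mono_right hVv) hU hV).trans ?_
    rw [← hdet]
    exact polyHeight_det_hasseDeriv_le (fun i => le_rfl) hP0 _ (hdet ▸ mul_ne_zero hU hV)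
  · rw [← hdet]
    refine translate_det_hasseDeriv_mem_orderIdeal hP ht hd (hn.trans (Nat.succ_le_succ hPd))
      (fun i => weight_le_of_degree_le hd hσ (fun k hk => ?_) ?_)
      fun i => weight_le_div_of_support_subset (he'j i) (he' i)
    · obtain ⟨hkj, hkP⟩ := Finset.mem_erase.1 (heP i hk)
      exact hdσ k hkP hkj
    · have hi : (i : ℕ) < degreeOf j P + 1 := i.2.trans_le hn
      exact (he i).trans ((Nat.le_of_lt_succ hi).trans hPd)

end Wronskian

section RothLemma

theorem sum_add_le_two_mul {ι : Type*} [LinearOrder ι] {S : Finset ι} {d : ι → ℝ} {B : ℝ}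
    (hB : ∀ i ∈ S, d i ≤ B) (hd : ∀ i ∈ S, ∀ j ∈ S, i < j → 2 * d j ≤ d i) {j : ι} (hj : j ∈ S)
    (hmax : ∀ i ∈ S, i ≤ j) : ∑ i ∈ S, d i + d j ≤ 2 * B := by
  induction S using Finset.induction_on_max generalizing j with
  | empty => simp at hj
  | insert a S haS ih =>
    obtain rfl : j = a := by
      rcases Finset.mem_insert.1 hj with h | h
      · exact h
      · exact absurd (hmax a (Finset.mem_insert_self a S)) (haS j h).not_ge
    rw [Finset.sum_insert fun h => lt_irrefl j (haS j h)]
    rcases S.eq_empty_or_nonempty with rfl | hS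
    · have := hB j hj
      rw [Finset.sum_empty]
      linarith
    · have hS' := ih (fun i hi => hB i (Finset.mem_insert_of_mem hi))
        (fun i hi k hk => hd i (Finset.mem_insert_of_mem hi) k (Finset.mem_insert_of_mem hk))
        (S.max'_mem hS) fun i hi => S.le_max' i hi
      have := hd _ (Finset.mem_insert_of_mem (S.max'_mem hS)) j hj (haS _ (S.max'_mem hS))
      linarith

theorem rpow_one_div_two_pow_succ_sq {σ : ℝ} (hσ : 0 ≤ σ) (k : ℕ) :
    (σ ^ ((1 : ℝ) / 2 ^ (k + 1))) ^ 2 = σ ^ ((1 : ℝ) / 2 ^ k) := by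
  rw [← Real.rpow_mul_natCast hσ]
  congr 1
  field_simp
  norm_num
  ring

theorem le_rpow_one_div_two_pow {σ : ℝ} (hσ0 : 0 < σ) (hσ1 : σ ≤ 1) (k : ℕ) :
    σ ≤ σ ^ ((1 : ℝ) / 2 ^ k) := by
  refine (Real.rpow_one σ).symm.trans_le (Real.rpow_le_rpow_of_exponent_ge hσ0 hσ1 ?_)
  exact div_le_one_of_le₀ (one_le_pow₀ one_le_two) (by positivity)

theorem le_of_half_min_sq_sub_le {σ : ℝ} (hσ0 : 0 < σ) (hσ1 : σ ≤ 1) {k : ℕ} {t : ℝ}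
    (ht : t ≤ k + 2)
    (h : min t (t ^ 2) / 2 - 2 * σ ≤ 2 * (k + 1) * σ ^ ((1 : ℝ) / 2 ^ k)) :
    t ≤ 2 * (k + 2) * σ ^ ((1 : ℝ) / 2 ^ (k + 1)) := by
  have hσk := le_rpow_one_div_two_pow hσ0 hσ1 k
  refine le_two_mul_of_min_sq_le (by linarith [k.cast_nonneg (α := ℝ)]) ht
    (Real.rpow_pos_of_pos hσ0 _) ?_
  rw [rpow_one_div_two_pow_succ_sq hσ0.le]
  linarith

theorem log_add_sum_degreeOf_le {ι R : Type*} [Fintype ι] [LinearOrder ι] [CommRing R]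
    {d : ι → ℕ} {S : Finset ι} {B : ℝ}
    (hB : ∀ i ∈ S, (d i : ℝ) ≤ B) (hd : ∀ i ∈ S, ∀ j ∈ S, i < j → 2 * (d j : ℝ) ≤ d i) {j : ι}
    (hj : j ∈ S) (hmax : ∀ i ∈ S, i ≤ j) {P : MvPolynomial ι R} (hPS : P.vars ⊆ S)
    (hPd : ∀ i ∈ S, degreeOf i P ≤ d i) {n : ℕ} (hn0 : 0 < n) (hn : n ≤ degreeOf j P + 1) :
    Real.log n + 2 * (∑ i, degreeOf i P : ℕ) * Real.log 2 ≤ 2.8 * B := by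
  have hlogn : Real.log n ≤ d j * Real.log 2 := by
    rw [← Real.log_pow]
    refine Real.log_le_log (mod_cast hn0) ?_
    exact_mod_cast (hn.trans (Nat.succ_le_succ (hPd j hj))).trans
      (Nat.succ_le_of_lt Nat.lt_two_pow_self)
  have hsum : ((∑ i, degreeOf i P : ℕ) : ℝ) ≤ ∑ i ∈ S, (d i : ℝ) := by
    rw [← Finset.sum_subset S.subset_univ fun i _ hi => vars_subset_iff_degreeOf.1 hPS i hi]
    exact_mod_cast Finset.sum_le_sum hPd
  have hgeom := sum_add_le_two_mul hB hd hj hmax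
  have hdj : (0 : ℝ) ≤ d j := Nat.cast_nonneg _
  have hlog2 : Real.log 2 ≤ 0.7 := Real.log_two_lt_d9.le.trans (by norm_num)
  calc Real.log n + 2 * (∑ i, degreeOf i P : ℕ) * Real.log 2
      ≤ (d j + 2 * ∑ i ∈ S, (d i : ℝ)) * Real.log 2 := by
        rw [add_mul]
        gcongr
    _ ≤ (4 * B) * 0.7 := by
        have hB0 : 0 ≤ B := hdj.trans (hB j hj)
        have := Real.log_nonneg one_le_two
        gcongr
        linarith
    _ = 2.8 * B := by ring

variable {ι K : Type*} [Field K] [NumberField K] {σ : ℝ} {ξ : ι → K} {d : ι → ℕ}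

theorem order_le_mul_of_vars_subset_singleton (hσ : 0 < σ) {j : ι} (hd : 0 < d j)
    {f : MvPolynomial ι K} (hf : f.vars ⊆ {j}) (hf0 : f ≠ 0) {n : ℕ} (hn : 0 < n)
    (hfd : degreeOf j f ≤ n * d j) {H : ℝ} (hfH : polyHeight f + n * d j ≤ n * H)
    (hξ : σ⁻¹ * H ≤ d j * absHeight ![ξ j, 1]) {t : ℝ} (ht : translate ξ f ∈ orderIdeal d t) :
    t ≤ n * σ := by
  have hdeg : degreeOf j f * Real.log 2 ≤ n * d j := by
    have hlog2 : Real.log 2 ≤ 1 := Real.log_two_lt_d9.le.trans (by norm_num)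
    exact (mul_le_of_le_one_right (Nat.cast_nonneg _) hlog2).trans (mod_cast hfd)
  have hH : 0 < H := by
    have hnd : (0 : ℝ) < n * d j := mod_cast Nat.mul_pos hn hd
    exact pos_of_mul_pos_right ((add_pos_of_nonneg_of_pos (polyHeight_nonneg f) hnd).trans_le hfH)
      (Nat.cast_nonneg n)
  have hpos : 0 < d j * absHeight ![ξ j, 1] := (mul_pos (inv_pos.2 hσ) hH).trans_le hξ
  refine le_of_mul_le_mul_right ?_ hpos
  calc t * (d j * absHeight ![ξ j, 1])
      ≤ polyHeight f + degreeOf j f * Real.log 2 := order_mul_absHeight_le hd hf hf0 ht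
    _ ≤ n * H := by linarith
    _ ≤ n * (σ * (d j * absHeight ![ξ j, 1])) := by
      gcongr
      exact (inv_mul_le_iff₀ hσ).1 hξ
    _ = n * σ * (d j * absHeight ![ξ j, 1]) := (mul_assoc ..).symm

theorem exists_mem_orderIdeal_erase_max [Finite ι] [LinearOrder ι] (hσ0 : 0 < σ) (hσ : σ ≤ 1 / 2)
    {S : Finset ι} {B : ℝ} (hB : ∀ i ∈ S, (d i : ℝ) ≤ B)
    (hdσ : ∀ i ∈ S, ∀ j ∈ S, i < j → (d j : ℝ) ≤ σ * d i) {j : ι} (hj : j ∈ S)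
    (hmax : ∀ i ∈ S, i ≤ j) (hd : 0 < d j) {P : MvPolynomial ι K} (hP0 : P ≠ 0) (hPS : P.vars ⊆ S)
    (hPd : ∀ i ∈ S, degreeOf i P ≤ d i) {H : ℝ} (hPH : polyHeight P + 4 * B ≤ H)
    (hξ : σ⁻¹ * H ≤ d j * absHeight ![ξ j, 1]) {t : ℝ} (ht0 : 0 ≤ t)
    (ht : translate ξ P ∈ orderIdeal d t) :
    ∃ (n : ℕ) (U : MvPolynomial ι K), 0 < n ∧ U ≠ 0 ∧ U.vars ⊆ S.erase j ∧
      (∀ i ∈ S.erase j, degreeOf i U ≤ n * d i) ∧ polyHeight U ≤ n * (polyHeight P + 4 * B) ∧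
      translate ξ U ∈ orderIdeal (fun i => n * d i) (min t (t ^ 2) / 2 - 2 * σ) := by
  cases nonempty_fintype ι
  obtain ⟨n, U, V, hn0, hn, ⟨hU0, hUv, hUd⟩, ⟨hV0, hVv, hVd⟩, hUV, hmem⟩ :=
    exists_wronskian_factors hP0 hd (hPd j hj) hσ0.le
      (fun i hi hij => hdσ i (hPS hi) j hj ((hmax i (hPS hi)).lt_of_ne hij)) ht0 ht
  have hdisj : Disjoint (translate ξ U).vars (translate ξ V).vars :=
    (Finset.disjoint_singleton_right.2 (Finset.notMem_erase j P.vars)).mono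
      ((vars_translate_subset ξ U).trans hUv) ((vars_translate_subset ξ V).trans hVv)
  rw [map_mul] at hmem
  obtain ⟨a, b, hab, ha, hb⟩ := exists_mem_orderIdeal_of_mul_mem hdisj
    (translate_ne_zero ξ hU0) (translate_ne_zero ξ hV0) hmem
  have hn' : (0 : ℝ) < n := Nat.cast_pos.2 hn0
  have hUV' : polyHeight U + polyHeight V ≤ n * (polyHeight P + 2.8 * B) := by
    have hd2 : ∀ i ∈ S, ∀ k ∈ S, i < k → 2 * (d k : ℝ) ≤ d i := fun i hi k hk hik => by
      have : σ * (d i : ℝ) ≤ 1 / 2 * d i := by gcongr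
      linarith [hdσ i hi k hk hik]
    refine hUV.trans ?_
    rw [add_assoc]
    gcongr
    exact log_add_sum_degreeOf_le hB hd2 hj hmax hPS hPd hn0 hn
  have hnd : 0 ≤ n * (d j : ℝ) := by positivity
  have hnB : n * (d j : ℝ) ≤ n * B := mul_le_mul_of_nonneg_left (hB j hj) hn'.le
  have hnH := mul_le_mul_of_nonneg_left hPH hn'.le
  have hb' : b ≤ n * σ :=
    order_le_mul_of_vars_subset_singleton hσ0 hd hVv hV0 hn0
      (hVd.trans (Nat.mul_le_mul_left n (hPd j hj))) (by linarith [polyHeight_nonneg U]) hξ hb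
  refine ⟨n, U, hn0, hU0, hUv.trans (Finset.erase_subset_erase j hPS), fun i hi =>
    (hUd i).trans (Nat.mul_le_mul_left n (hPd i (Finset.mem_of_mem_erase hi))), ?_,
    fun s hs => le_trans ?_ (mem_orderIdeal_const_mul ha s hs)⟩
  · linarith [polyHeight_nonneg V]
  · rw [le_div_iff₀ hn']
    linarith

theorem roth_lemma [Finite ι] [LinearOrder ι] (hσ0 : 0 < σ) (hσ : σ ≤ 1 / 2) (k : ℕ)
    {S : Finset ι} (hS : S.card = k + 1) (hd : ∀ i ∈ S, 0 < d i) {B : ℝ}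
    (hB : ∀ i ∈ S, (d i : ℝ) ≤ B) (hdσ : ∀ i ∈ S, ∀ j ∈ S, i < j → (d j : ℝ) ≤ σ * d i)
    {P : MvPolynomial ι K} (hP0 : P ≠ 0) (hPS : P.vars ⊆ S) (hPd : ∀ i ∈ S, degreeOf i P ≤ d i)
    {H : ℝ} (hPH : polyHeight P + 4 * (k + 1) * B ≤ H)
    (hξ : ∀ i ∈ S, σ⁻¹ * H ≤ d i * absHeight ![ξ i, 1])
    {t : ℝ} (ht : translate ξ P ∈ orderIdeal d t) :
    t ≤ 2 * (k + 1) * σ ^ ((1 : ℝ) / 2 ^ k) := by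
  induction k generalizing S d B P H t with
  | zero =>
    obtain ⟨j, rfl⟩ := Finset.card_eq_one.1 hS
    simp only [Finset.mem_singleton, forall_eq] at hd hB hPd hξ
    have htσ : t ≤ (1 : ℕ) * σ := by
      refine order_le_mul_of_vars_subset_singleton hσ0 hd hPS hP0 one_pos (by simpa using hPd)
        ?_ hξ ht
      norm_num at hPH ⊢
      linarith [(d j).cast_nonneg (α := ℝ)]
    norm_num at htσ ⊢
    linarith
  | succ k ih =>
    rcases lt_or_ge t 0 with hneg | ht0
    · exact hneg.le.trans (by positivity)
    obtain ⟨j, hj, hmax⟩ := S.exists_max_image id (Finset.card_pos.1 (hS ▸ (k + 1).succ_pos))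
    have hB0 : 0 ≤ B := (Nat.cast_nonneg _).trans (hB j hj)
    have hkB : 0 ≤ k * B := by positivity
    push_cast at hPH
    obtain ⟨n, U, hn0, hU0, hUv, hUd, hUP, hU⟩ :=
      exists_mem_orderIdeal_erase_max hσ0 hσ hB hdσ hj hmax (hd j hj) hP0 hPS hPd
        (by linarith) (hξ j hj) ht0 ht
    have hsub : ∀ i ∈ S.erase j, i ∈ S := fun i => Finset.mem_of_mem_erase
    have hU' := ih (B := n * B) (H := n * H) (by rw [Finset.card_erase_of_mem hj, hS]; rfl)
      (fun i hi => Nat.mul_pos hn0 (hd i (hsub i hi))) (fun i hi => ?_)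
      (fun i hi l hl hil => ?_) hU0 hUv hUd ?_ (fun i hi => ?_) hU
    · have htk := le_card_of_mem_orderIdeal ((vars_translate_subset ξ P).trans hPS)
        (fun i hi => (degreeOf_translate_le ξ i P).trans (hPd i hi)) (translate_ne_zero ξ hP0) ht
      rw [hS] at htk
      push_cast [add_assoc, one_add_one_eq_two] at htk ⊢
      exact le_of_half_min_sq_sub_le hσ0 (by linarith) htk hU'
    · simpa using mul_le_mul_of_nonneg_left (hB i (hsub i hi)) n.cast_nonneg
    · rw [Nat.cast_mul, Nat.cast_mul, mul_left_comm]
      exact mul_le_mul_of_nonneg_left (hdσ i (hsub i hi) l (hsub l hl) hil) n.cast_nonneg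
    · linarith [mul_le_mul_of_nonneg_left hPH n.cast_nonneg]
    · rw [Nat.cast_mul, mul_left_comm, mul_assoc]
      exact mul_le_mul_of_nonneg_left (hξ i (hsub i hi)) n.cast_nonneg

end RothLemma

section Ratio

open Height

variable {ι K : Type*} [Fintype ι] [Field K] [NumberField K] {b : ι → K} {i₀ : ι}

theorem absHeight_le_sum_absHeight_div (hb : b i₀ ≠ 0) :
    absHeight b ≤ ∑ i, absHeight ![b i / b i₀, 1] := by
  classical
  let x : ι → Fin 2 → K := fun i => ![b i / b i₀, 1]
  have hx : ∀ i, x i ≠ 0 := fun i h => one_ne_zero (congrFun h 1)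
  have hcomp : (b i₀)⁻¹ • b =
      (fun J : ι → Fin 2 => ∏ a, x a (J a)) ∘ fun i a => if a = i then 0 else 1 := by
    funext i
    have : ∀ a, x a (if a = i then 0 else 1) = if a = i then b a / b i₀ else 1 := fun a => by
      split_ifs <;> rfl
    simp [this, div_eq_inv_mul]
  rw [← absHeight_smul b (inv_ne_zero hb), hcomp]
  refine (absHeight_comp_le _ _).trans_eq ?_
  rw [absHeight, logHeight_fun_prod_eq hx, Finset.sum_div]
  rfl

theorem exists_absHeight_le_card_mul_absHeight_neg_div [Nontrivial ι] (hb : b ≠ 0) :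
    ∃ i₀ i₁, i₁ ≠ i₀ ∧ b i₀ ≠ 0 ∧
      absHeight b ≤ (Fintype.card ι - 1 : ℕ) * absHeight ![-b i₁ / b i₀, 1] := by
  classical
  obtain ⟨i₀, hi₀⟩ := Function.ne_iff.1 hb
  obtain ⟨i', hi'⟩ := exists_ne i₀
  obtain ⟨i₁, hi₁, hmax⟩ := (Finset.univ.erase i₀).exists_max_image
    (fun i => absHeight ![b i / b i₀, 1]) ⟨i', by simpa using hi'⟩
  refine ⟨i₀, i₁, Finset.ne_of_mem_erase hi₁, hi₀, (absHeight_le_sum_absHeight_div hi₀).trans ?_⟩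
  have hself : absHeight ![b i₀ / b i₀, 1] = 0 := by
    rw [div_self hi₀, absHeight, ← logHeight₁_eq_logHeight, logHeight₁_one, zero_div]
  have hneg : absHeight ![-b i₁ / b i₀, 1] = absHeight ![b i₁ / b i₀, 1] := by
    rw [neg_div, absHeight, absHeight, ← logHeight₁_eq_logHeight, ← logHeight₁_eq_logHeight,
      logHeight₁_neg]
  rw [← Finset.add_sum_erase _ _ (Finset.mem_univ i₀), hself, zero_add, hneg,
    ← Finset.card_univ, ← Finset.card_erase_of_mem (Finset.mem_univ i₀), ← nsmul_eq_mul]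
  exact Finset.sum_le_card_nsmul _ _ _ hmax

end Ratio

section Slice

variable {m n : ℕ} (i₀ i₁ : Fin m → Fin (n + 1))

/-- The exponents of the pivot variables `X_{h, i₀ h}` in a monomial of exponent `s`. -/
noncomputable def pivotExponent (s : Fin m × Fin (n + 1) →₀ ℕ) : Fin m →₀ ℕ :=
  Finsupp.equivFunOnFinite.symm fun h => s (h, i₀ h)

/-- The exponents of the variables other than `X_{h, i₀ h}` and `X_{h, i₁ h}` in a monomial of
exponent `s`. -/
noncomputable def restExponent (s : Fin m × Fin (n + 1) →₀ ℕ) : Fin m × Fin (n + 1) →₀ ℕ :=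
  s.filter fun p => p.2 ≠ i₀ p.1 ∧ p.2 ≠ i₁ p.1

/-- The polynomial in the pivot variables `X_{h, i₀ h}`, indexed by `h`, that is obtained from `P`
by setting each `X_{h, i₁ h}` equal to `1` and taking the coefficient of the monomial of exponent
`e` in the remaining variables. -/
noncomputable def slice {R : Type*} [CommSemiring R] (e : Fin m × Fin (n + 1) →₀ ℕ)
    (P : MvPolynomial (Fin m × Fin (n + 1)) R) : MvPolynomial (Fin m) R :=
  ∑ s ∈ P.support with restExponent i₀ i₁ s = e, monomial (pivotExponent i₀ s) (coeff s P)

variable {i₀ i₁}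

theorem map_slice {R R' : Type*} [CommSemiring R] [CommSemiring R'] {φ : R →+* R'}
    (hφ : Function.Injective φ) (e : Fin m × Fin (n + 1) →₀ ℕ)
    (P : MvPolynomial (Fin m × Fin (n + 1)) R) :
    map φ (slice i₀ i₁ e P) = slice i₀ i₁ e (map φ P) := by
  simp only [slice, map_sum, support_map_of_injective _ hφ, map_monomial, coeff_map]

theorem eq_of_restExponent_eq_of_pivotExponent_eq {s r : Fin m × Fin (n + 1) →₀ ℕ}
    (hsum : ∀ h, ∑ i, s (h, i) = ∑ i, r (h, i))
    (hrest : restExponent i₀ i₁ s = restExponent i₀ i₁ r)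
    (hpivot : pivotExponent i₀ s = pivotExponent i₀ r) : s = r := by
  have hne : ∀ h i, i ≠ i₁ h → s (h, i) = r (h, i) := fun h i hi₁ => by
    by_cases hi₀ : i = i₀ h
    · exact hi₀ ▸ DFunLike.congr_fun hpivot h
    · simpa [restExponent, Finsupp.filter_apply, hi₀, hi₁] using DFunLike.congr_fun hrest (h, i)
  ext ⟨h, i⟩
  by_cases hi₁ : i = i₁ h
  · subst hi₁
    have hs := hsum h
    rw [← Finset.add_sum_erase _ _ (Finset.mem_univ (i₁ h)),
      ← Finset.add_sum_erase _ (fun i => r (h, i)) (Finset.mem_univ (i₁ h)),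
      Finset.sum_congr rfl fun i hi => hne h i (Finset.ne_of_mem_erase hi)] at hs
    exact Nat.add_right_cancel hs
  · exact hne h i hi₁

variable {R : Type*} [CommSemiring R] {d : Fin m → ℕ} {e s : Fin m × Fin (n + 1) →₀ ℕ}
  {P : MvPolynomial (Fin m × Fin (n + 1)) R}

theorem coeff_pivotExponent_slice (hP : IsMultihomogeneous d P) (hs : s ∈ P.support)
    (hse : restExponent i₀ i₁ s = e) :
    coeff (pivotExponent i₀ s) (slice i₀ i₁ e P) = coeff s P := by
  rw [slice, coeff_sum, Finset.sum_eq_single_of_mem s (Finset.mem_filter.2 ⟨hs, hse⟩),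
    coeff_monomial, if_pos rfl]
  intro r hr hrs
  obtain ⟨hr, hre⟩ := Finset.mem_filter.1 hr
  rw [coeff_monomial, if_neg fun h => hrs (eq_of_restExponent_eq_of_pivotExponent_eq
    (fun h => (hP r hr h).trans (hP s hs h).symm) (hre.trans hse.symm) h)]

theorem exists_pivotExponent_eq_of_mem_support_slice {r : Fin m →₀ ℕ}
    (hr : r ∈ (slice i₀ i₁ e P).support) :
    ∃ s ∈ P.support, restExponent i₀ i₁ s = e ∧ pivotExponent i₀ s = r := by
  rw [mem_support_iff, slice, coeff_sum] at hr
  obtain ⟨s, hs, hne⟩ := Finset.exists_ne_zero_of_sum_ne_zero hr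
  obtain ⟨hs, hse⟩ := Finset.mem_filter.1 hs
  refine ⟨s, hs, hse, ?_⟩
  rw [coeff_monomial] at hne
  exact of_not_not fun h => hne (if_neg h)

theorem degreeOf_slice_le (hP : IsMultihomogeneous d P) (h : Fin m) :
    degreeOf h (slice i₀ i₁ e P) ≤ d h := by
  refine degreeOf_le_iff.2 fun r hr => ?_
  obtain ⟨s, hs, -, rfl⟩ := exists_pivotExponent_eq_of_mem_support_slice hr
  rw [← hP s hs h]
  exact Finset.single_le_sum (f := fun i => s (h, i)) (fun _ _ => Nat.zero_le _)
    (Finset.mem_univ (i₀ h))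

theorem slice_ne_zero (hP : IsMultihomogeneous d P) (hs : s ∈ P.support) :
    slice i₀ i₁ (restExponent i₀ i₁ s) P ≠ 0 := fun h => by
  have hcoeff := coeff_pivotExponent_slice (i₀ := i₀) (i₁ := i₁) hP hs rfl
  rw [h, coeff_zero] at hcoeff
  exact mem_support_iff.1 hs hcoeff.symm

theorem polyHeight_slice_le {K : Type*} [Field K] [NumberField K]
    {P : MvPolynomial (Fin m × Fin (n + 1)) K} (hP : IsMultihomogeneous d P) :
    polyHeight (slice i₀ i₁ e P) ≤ polyHeight P := by
  have hex : ∀ r ∈ (slice i₀ i₁ e P).support, ∃ s, coeff r (slice i₀ i₁ e P) = coeff s P :=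
    fun r hr => by
      obtain ⟨s, hs, hse, rfl⟩ := exists_pivotExponent_eq_of_mem_support_slice hr
      exact ⟨s, coeff_pivotExponent_slice hP hs hse⟩
  choose! g hg using hex
  exact polyHeight_le_of_coeff_eq g hg

end Slice

section Substitution

variable {m n : ℕ} {i₀ i₁ : Fin m → Fin (n + 1)} {F : Type*} [Field F] {d : Fin m → ℕ} {t : ℝ}
  {P : MvPolynomial (Fin m × Fin (n + 1)) F}

variable (i₀ i₁) in
/-- The solution for `X_{h, i₀ h}` of the equation `M_h(X_h) = M_{h, i₀ h} Y_h` with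
`X_{h, i₁ h} = 1`, where the new variables `Y_h` are those of the coefficient ring. -/
noncomputable def pivotImage (M : Fin m → Fin (n + 1) → F) (h : Fin m) :
    MvPolynomial (Fin m × Fin (n + 1)) (MvPolynomial (Fin m) F) :=
  C (X h + C (-M h (i₁ h) / M h (i₀ h))) -
    ∑ i with i ≠ i₀ h ∧ i ≠ i₁ h, C (C (M h i / M h (i₀ h))) * X (h, i)

variable (i₀ i₁) in
/-- The substitution that dehomogenizes each block at `X_{h, i₁ h}` and takes the linear form `M_h`
as new variable in place of `X_{h, i₀ h}`; only the other variables keep their role. -/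
noncomputable def linFormSubst (M : Fin m → Fin (n + 1) → F) :
    MvPolynomial (Fin m × Fin (n + 1)) F →ₐ[F]
      MvPolynomial (Fin m × Fin (n + 1)) (MvPolynomial (Fin m) F) :=
  aeval fun p => if p.2 = i₀ p.1 then pivotImage i₀ i₁ M p.1 else if p.2 = i₁ p.1 then 1 else X p

theorem linFormSubst_linForm {M : Fin m → Fin (n + 1) → F} {h : Fin m} (hi : i₁ h ≠ i₀ h)
    (hM : M h (i₀ h) ≠ 0) :
    linFormSubst i₀ i₁ M (linForm (M h) h) = C (C (M h (i₀ h)) * X h) := by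
  have hrest : (Finset.univ.erase (i₀ h)).erase (i₁ h) =
      Finset.univ.filter fun i => i ≠ i₀ h ∧ i ≠ i₁ h := by
    ext i
    simp [and_comm]
  have hscale : ∀ a, (C (C a) : MvPolynomial (Fin m × Fin (n + 1)) (MvPolynomial (Fin m) F)) =
      C (C (M h (i₀ h))) * C (C (a / M h (i₀ h))) := fun a => by
    rw [← C_mul, ← C_mul, mul_div_cancel₀ a hM]
  have hvar : ∀ i, linFormSubst i₀ i₁ M (C (M h i) * X (h, i)) = C (C (M h i)) *
      if i = i₀ h then pivotImage i₀ i₁ M h else if i = i₁ h then 1 else X (h, i) := fun i => by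
    rw [linFormSubst, map_mul, aeval_X, aeval_C]
    rfl
  have hothers : ∑ i with i ≠ i₀ h ∧ i ≠ i₁ h, C (C (M h i)) *
      (if i = i₀ h then pivotImage i₀ i₁ M h else if i = i₁ h then 1 else X (h, i)) =
      C (C (M h (i₀ h))) *
        ∑ i with i ≠ i₀ h ∧ i ≠ i₁ h, C (C (M h i / M h (i₀ h))) * X (h, i) := by
    rw [Finset.mul_sum]
    refine Finset.sum_congr rfl fun i hi => ?_
    obtain ⟨hi₀, hi₁⟩ := (Finset.mem_filter.1 hi).2
    rw [if_neg hi₀, if_neg hi₁, ← mul_assoc, ← hscale]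
  rw [linForm, map_sum, Finset.sum_congr rfl fun i _ => hvar i,
    ← Finset.add_sum_erase _ _ (Finset.mem_univ (i₀ h)),
    ← Finset.add_sum_erase _ _ (Finset.mem_erase.2 ⟨hi, Finset.mem_univ (i₁ h)⟩), hrest, hothers,
    if_pos rfl, if_neg hi, if_pos rfl, mul_one, pivotImage, neg_div, C_neg, C_add, C_neg, C_mul,
    hscale (M h (i₁ h))]
  ring

theorem linFormSubst_mem_map_orderIdeal {M : Fin m → Fin (n + 1) → F} (hi : ∀ h, i₁ h ≠ i₀ h)
    (hM : ∀ h, M h (i₀ h) ≠ 0) (hP : P ∈ indexIdeal t d M) :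
    linFormSubst i₀ i₁ M P ∈
      Ideal.map C (orderIdeal d t : Ideal (MvPolynomial (Fin m) F)) := by
  suffices hle : indexIdeal t d M ≤ Ideal.comap (linFormSubst i₀ i₁ M)
      (Ideal.map C (orderIdeal d t : Ideal (MvPolynomial (Fin m) F))) from hle hP
  rw [indexIdeal, Ideal.span_le]
  rintro _ ⟨J, hJ, rfl⟩
  rw [SetLike.mem_coe, Ideal.mem_comap, map_prod]
  simp only [map_pow, linFormSubst_linForm (hi _) (hM _)]
  simp only [← map_pow, ← map_prod]
  have hX : ∀ h ∈ Finset.univ, (C (M h (i₀ h)) * X h) ^ J h ∈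
      orderIdeal d (J h / d h : ℝ) := fun h _ s hs => by
    rw [C_mul_X_eq_monomial, monomial_pow, coeff_monomial] at hs
    rw [← (ite_ne_right_iff.1 hs).1, Finsupp.smul_single, weight_apply,
      Finsupp.sum_single_index (by simp), smul_eq_mul, mul_one, div_eq_mul_inv]
  exact Ideal.mem_map_of_mem C fun s hs => hJ.trans (prod_mem_orderIdeal _ hX s hs)

theorem linFormSubst_monomial (M : Fin m → Fin (n + 1) → F) (s : Fin m × Fin (n + 1) →₀ ℕ) (a : F) :
    linFormSubst i₀ i₁ M (monomial s a) = C (C a) *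
      ((∏ h, pivotImage i₀ i₁ M h ^ s (h, i₀ h)) * monomial (restExponent i₀ i₁ s) 1) := by
  have hvar : ∀ p : Fin m × Fin (n + 1),
      (if p.2 = i₀ p.1 then pivotImage i₀ i₁ M p.1 else if p.2 = i₁ p.1 then 1 else X p) ^ s p =
        (if p.2 = i₀ p.1 then pivotImage i₀ i₁ M p.1 ^ s p else 1) *
          X p ^ restExponent i₀ i₁ s p := fun p => by
    rw [restExponent, Finsupp.filter_apply]
    split_ifs <;> simp_all
  rw [linFormSubst, aeval_monomial, Finsupp.prod_fintype _ _ fun p => pow_zero _,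
    Finset.prod_congr rfl fun p _ => hvar p, Finset.prod_mul_distrib, Fintype.prod_prod_type,
    monomial_eq, C_1, one_mul, Finsupp.prod_fintype _ _ fun p => pow_zero _]
  simp only [Finset.prod_ite_eq', Finset.mem_univ, if_true]
  rfl

theorem coeff_linFormSubst (M : Fin m → Fin (n + 1) → F) {e : Fin m × Fin (n + 1) →₀ ℕ}
    (he : ∀ s ∈ P.support, restExponent i₀ i₁ s ≤ e → restExponent i₀ i₁ s = e) :
    coeff e (linFormSubst i₀ i₁ M P) =
      translate (fun h => -M h (i₁ h) / M h (i₀ h)) (slice i₀ i₁ e P) := by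
  conv_lhs => rw [P.as_sum]
  rw [map_sum, coeff_sum, slice, map_sum, Finset.sum_filter]
  refine Finset.sum_congr rfl fun s hs => ?_
  have hconst : constantCoeff (∏ h, pivotImage i₀ i₁ M h ^ s (h, i₀ h)) =
      ∏ h, (X h + C (-M h (i₁ h) / M h (i₀ h))) ^ s (h, i₀ h) := by
    simp [pivotImage]
  rw [linFormSubst_monomial, coeff_C_mul, coeff_mul_monomial']
  by_cases hse : restExponent i₀ i₁ s = e
  · rw [if_pos hse, if_pos hse.le, hse, tsub_self, mul_one, ← constantCoeff_eq, hconst, translate,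
      aeval_monomial, Finsupp.prod_fintype _ _ fun p => pow_zero _]
    rfl
  · rw [if_neg hse, if_neg fun h => hse (he s hs h), mul_zero]

theorem translate_slice_mem_orderIdeal {F' : Type*} [Field F'] (φ : F →+* F')
    {M : Fin m → Fin (n + 1) → F} (hi : ∀ h, i₁ h ≠ i₀ h) (hM : ∀ h, M h (i₀ h) ≠ 0)
    {e : Fin m × Fin (n + 1) →₀ ℕ}
    (he : ∀ s ∈ P.support, restExponent i₀ i₁ s ≤ e → restExponent i₀ i₁ s = e)
    (hP : map φ P ∈ indexIdeal t d fun h i => φ (M h i)) :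
    translate (fun h => -M h (i₁ h) / M h (i₀ h)) (slice i₀ i₁ e P) ∈ orderIdeal d t := by
  have hmem := mem_map_C_iff.1 (linFormSubst_mem_map_orderIdeal hi
    (M := fun h i => φ (M h i)) (by simpa using hM) hP) e
  rw [coeff_linFormSubst, ← map_slice φ.injective] at hmem
  · have hφ : (fun h => -φ (M h (i₁ h)) / φ (M h (i₀ h))) =
        fun h => φ (-M h (i₁ h) / M h (i₀ h)) := by
      funext h
      rw [map_div₀, map_neg]
    rw [hφ, ← map_translate] at hmem
    refine fun s hs => hmem s ?_
    rwa [coeff_map, ne_eq, map_eq_zero]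
  · exact fun s hs => he s (support_map_subset _ _ hs)

theorem exists_dehomogenization {K L : Type*} [Field K] [NumberField K] [Field L] (φ : K →+* L)
    {P : MvPolynomial (Fin m × Fin (n + 1)) K} (hP0 : P ≠ 0) (hP : IsMultihomogeneous d P)
    {M : Fin m → Fin (n + 1) → K} (hi : ∀ h, i₁ h ≠ i₀ h) (hM : ∀ h, M h (i₀ h) ≠ 0) :
    ∃ f : MvPolynomial (Fin m) K, f ≠ 0 ∧ (∀ h, degreeOf h f ≤ d h) ∧
      polyHeight f ≤ polyHeight P ∧
      ∀ t, map φ P ∈ indexIdeal t d (fun h i => φ (M h i)) →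
        translate (fun h => -M h (i₁ h) / M h (i₀ h)) f ∈ orderIdeal d t := by
  classical
  obtain ⟨e, he, hmin⟩ := Finset.exists_minimal
    ((support_nonempty.2 hP0).image (restExponent i₀ i₁))
  obtain ⟨s, hs, rfl⟩ := Finset.mem_image.1 he
  exact ⟨slice i₀ i₁ (restExponent i₀ i₁ s) P, slice_ne_zero hP hs, degreeOf_slice_le hP,
    polyHeight_slice_le hP, fun t => translate_slice_mem_orderIdeal φ hi hM fun r hr hre =>
      hre.antisymm (hmin (Finset.mem_image_of_mem _ hr) hre)⟩

end Substitution

theorem antitone_of_succ_le_mul {k : ℕ} {d : Fin (k + 1) → ℕ} {σ : ℝ} (hσ : σ ≤ 1)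
    (hdσ : ∀ j : Fin k, (d j.succ : ℝ) ≤ σ * d j.castSucc) : Antitone d :=
  Fin.antitone_iff_succ_le.2 fun j => Nat.cast_le.1 <|
    (hdσ j).trans (mul_le_of_le_one_left (Nat.cast_nonneg _) hσ)

theorem le_mul_of_lt_of_succ_le_mul {k : ℕ} {d : Fin (k + 1) → ℕ} {σ : ℝ} (hσ0 : 0 ≤ σ)
    (hσ : σ ≤ 1) (hdσ : ∀ j : Fin k, (d j.succ : ℝ) ≤ σ * d j.castSucc) {i j : Fin (k + 1)}
    (hij : i < j) : (d j : ℝ) ≤ σ * d i := by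
  obtain ⟨j, rfl⟩ := Fin.exists_succ_eq.2 (Fin.ne_zero_of_lt hij)
  exact (hdσ j).trans <| mul_le_mul_of_nonneg_left
    (Nat.cast_le.2 <| antitone_of_succ_le_mul hσ hdσ (Fin.le_castSucc_iff.2 hij)) hσ0

end GenRoth

open GenRoth MvPolynomial in
theorem mainTheorem6_general {K L : Type*} [Field K] [NumberField K] [Field L] (φ : K →+* L)
    (m n : ℕ) (hm : 1 ≤ m) (hn : 1 ≤ n) (d : Fin m → ℕ) (hd : ∀ j, 0 < d j)
    (P : MvPolynomial (Fin m × Fin (n + 1)) K) (hP0 : P ≠ 0) (hP : IsMultihomogeneous d P)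
    (M : Fin m → Fin (n + 1) → K) (hM : ∀ j, M j ≠ 0) (σ : ℝ) (hσ0 : 0 < σ) (hσ : σ ≤ 1 / 2)
    (hdσ : ∀ (j : ℕ) (hj : j + 1 < m),
      (d ⟨j + 1, hj⟩ : ℝ) / (d ⟨j, Nat.lt_of_succ_lt hj⟩ : ℝ) ≤ σ)
    (hheight : ∀ j, n * σ⁻¹ * (polyHeight P + 4 * m * d ⟨0, hm⟩) ≤ d j * absHeight (M j)) :
    index d (fun j i => φ (M j i)) (map φ P) ≤
      ((2 * m * σ ^ ((1 : ℝ) / 2 ^ (m - 1)) : ℝ) : EReal) := by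
  obtain ⟨k, rfl⟩ := Nat.exists_eq_add_of_le' hm
  have : Nontrivial (Fin (n + 1)) := Fin.nontrivial_iff_two_le.2 (by omega)
  have hpivots : ∀ j, ∃ i₀ i₁, i₁ ≠ i₀ ∧ M j i₀ ≠ 0 ∧
      absHeight (M j) ≤ n * absHeight ![-M j i₁ / M j i₀, 1] := fun j => by
    simpa using exists_absHeight_le_card_mul_absHeight_neg_div (hM j)
  choose i₀ i₁ hne hpivot hratio using hpivots
  obtain ⟨f, hf0, hfd, hfP, hf⟩ := exists_dehomogenization φ hP0 hP hne hpivot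
  have hξ : ∀ j, σ⁻¹ * (polyHeight P + 4 * (k + 1 : ℕ) * d 0) ≤
      d j * absHeight ![-M j (i₁ j) / M j (i₀ j), 1] := fun j => by
    refine le_of_mul_le_mul_left ?_ (Nat.cast_pos.2 hn : (0 : ℝ) < n)
    rw [← mul_assoc, mul_left_comm]
    exact (hheight j).trans (mul_le_mul_of_nonneg_left (hratio j) (Nat.cast_nonneg _))
  have hstep : ∀ j : Fin k, (d j.succ : ℝ) ≤ σ * d j.castSucc := fun j =>
    (div_le_iff₀ (Nat.cast_pos.2 (hd _))).1 (hdσ j j.succ.isLt)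
  have hσ1 : σ ≤ 1 := by linarith
  refine sSup_le ?_
  rintro _ ⟨t, -, ht, rfl⟩
  rw [EReal.coe_le_coe_iff, Nat.cast_add_one, Nat.add_sub_cancel]
  exact roth_lemma hσ0 hσ k (Finset.card_fin _) (fun j _ => hd j)
    (fun j _ => Nat.cast_le.2 (antitone_of_succ_le_mul hσ1 hstep (Fin.zero_le j)))
    (fun i _ j _ hij => le_mul_of_lt_of_succ_le_mul hσ0.le hσ1 hstep hij) hf0
    (Finset.subset_univ _) (fun j _ => hfd j) (by push_cast; gcongr) (fun j _ => hξ j) (hf t ht)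

/-- Generalized Roth lemma. The coefficients of `P` and of the linear forms `M j` lie in a number
field `K`, embedded by `φ` in the algebraic closure of `ℚ`, over which the index is taken. -/
theorem mainTheorem6 {K : Type*} [Field K] [NumberField K] (φ : K →+* AlgebraicClosure ℚ)
    (m n : ℕ) (hm : 1 ≤ m) (hn : 1 ≤ n)
    (d : Fin m → ℕ) (hd : ∀ j, 0 < d j)
    (P : MvPolynomial (Fin m × Fin (n + 1)) K) (hP0 : P ≠ 0)
    (hP : GenRoth.IsMultihomogeneous d P)
    (M : Fin m → Fin (n + 1) → K) (hM : ∀ j, M j ≠ 0)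
    (σ : ℝ) (hσ0 : 0 < σ) (hσ : σ ≤ 1 / 2)
    (hdσ : ∀ (j : ℕ) (hj : j + 1 < m),
      (d ⟨j + 1, hj⟩ : ℝ) / (d ⟨j, Nat.lt_of_succ_lt hj⟩ : ℝ) ≤ σ)
    (hheight : ∀ j : Fin m,
      (n : ℝ) * σ⁻¹ * (GenRoth.polyHeight P + 4 * (m : ℝ) * (d ⟨0, hm⟩ : ℝ)) ≤
        (d j : ℝ) * GenRoth.absHeight (M j)) :
    GenRoth.index d (fun j i => φ (M j i)) (MvPolynomial.map φ P) ≤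
      ((2 * (m : ℝ) * σ ^ ((1 : ℝ) / (2 : ℝ) ^ (m - 1)) : ℝ) : EReal) :=
  mainTheorem6_general φ m n hm hn d hd P hP0 hP M hM σ hσ0 hσ hdσ hheight
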